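/- Let $m\ge 1$, $M=\{1,\dots,m\}$, $M_0=\{0\}\cup M$. Let $\lambda>0$, let $R=(r_{ij})_{i,j\in M_0}$ be a stochastic matrix, let $\mu_i(0)=0$ and $\inf_{n\ge1}\mu_i(n)>0$ for $i\in M$, and let $\psi,\phi$ be arbitrary positive functions on the subsets of $M$. Put, for $D\subset M$, $r^D_{ij}=r_{ij}$ if $i\ne j$ in $M_0\setminus D$, $r^D_{ii}=r_{ii}+\sum_{k\in D}r_{ik}$ if $i\in M_0\setminus D$, and $r^D_{ij}=0$ if $i\in D$ or $j\in D$. The unreliable Jackson network (with the RS-RD blocking rule) is the pure jump Markov process on $\tilde{\mathbb E}=\mathcal P(M)\times\mathbb Z_+^m$ with generator $$\begin{aligned}\tilde{\mathcal Q}f(D,n)=&\sum_{j}[f(D,n+e_j)-f(D,n)]\lambda r^D_{0j}+\sum_{i,j}[f(D,n-e_i+e_j)-f(D,n)]\mu_i(n_i)r^D_{ij}+\sum_{j}[f(D,n-e_j)-f(D,n)]\mu_j(n_j)r^D_{j0}\\&+\sum_{\emptyset\neq I\subset M\setminus D}[f(D\cup I,n)-f(D,n)]\frac{\psi(D\cup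 I)}{\psi(D)}+\sum_{\emptyset\neq H\subset D}[f(D\setminus H,n)-f(D,n)]\frac{\phi(D)}{\phi(D\setminus H)}.\end{aligned}$$ Let $(\tilde P_t)$ be its transition semigroup. Let $(\lambda_i)_{i\in M}$ solve the traffic equation $\lambda_i=\lambda r_{0i}+\sum_{j\in M}\lambda_jr_{ji}$, put $\lambda_0=\lambda$, and assume that $R$ is reversible, $\lambda_jr_{ji}=\lambda_ir_{ij}$ for $i,j\in M_0$, and regular, i.e. $R^k>0$ entrywise for some $k\ge1$. Let $$\pi_i(n)=\frac1{C_i}\frac{\lambda_i^{n}}{\prod_{k=1}^{n}\mu_i(k)},\quad C_i=\sum_{n\ge0}\frac{\lambda_i^{n}}{\prod_{k=1}^{n}\mu_i(k)},\qquad \pi(D,n)=\frac1C\frac{\psi(D)}{\phi(D)}\prod_{i=1}^m\pi_i(n_i),\quad C=\sum_{D\subset M}\frac{\psi(D)}{\phi(D)}.$$ Suppose that every $\pi_i$ is strongly light-tailed: it is a probability distribution ($C_i<\infty$) with $\inf_{k\ge0}\pi_i(k)/\sum_{j\ge k}\pi_i(j)>0$. Put $\mathrm{Gap}(\tilde{\mathcal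 Q})=\inf\{-\langle f,\tilde{\mathcal Q}f\rangle_\pi:\|f\|_2=1,\ \pi(f)=0\}$, where $f$ runs over the domain of the generator of $(\tilde P_t)$ in $L^2(\tilde{\mathbb E},\pi)$, $\langle f,g\rangle_\pi=\sum_e f(e)g(e)\pi(e)$, $\|f\|_2^2=\langle f,f\rangle_\pi$ and $\pi(f)=\langle f,1\rangle_\pi$. Then $\pi$ is a stationary distribution of $(\tilde P_t)$, $\mathrm{Gap}(\tilde{\mathcal Q})>0$, and both of the following hold: (i) for all $f\in L^2(\tilde{\mathbb E},\pi)$ and $t>0$, $\|\tilde P_tf-\pi(f)\|_2\le e^{-\mathrm{Gap}(\tilde{\mathcal Q})t}\|f-\pi(f)\|_2$; (ii) for each $e\in\tilde{\mathbb E}$ there is $C(e)>0$ such that $\|\delta_e\tilde P_t-\pi\|_{tv}\le C(e)e^{-\mathrm{Gap}(\tilde{\mathcal Q})t}$ for all $t>0$, where $\|\nu\|_{tv}=\sum_{y}|\nu(y)|$. -/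

import Mathlib

open scoped ENNReal Topology

noncomputable section

/-! ### Continuous-time Markov chains on a countable set -/

namespace MarkovChain

/-- One step of Feller's iteration: the integral operator of the backward equation (first-jump
decomposition) for the conservative intensity matrix `q`, whose diagonal entry `q x x` is minus
the exit rate of `x`:
`F ↦ δ_{xy} e^{q(x,x) t} + ∫_0^t e^{q(x,x) s} ∑_{z ≠ x} q(x,z) F_{t-s}(z,y) ds`. -/
def fellerStep {E : Type*} [DecidableEq E] (q : E → E → ℝ) (F : ℝ → E → E → ℝ≥0∞) :
    ℝ → E → E → ℝ≥0∞ :=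
  fun t x y =>
    (if x = y then ENNReal.ofReal (Real.exp (q x x * t)) else 0) +
      ∫⁻ s in Set.Ioc 0 t, ENNReal.ofReal (Real.exp (q x x * s)) *
        ∑' z, if z = x then 0 else ENNReal.ofReal (q x z) * F (t - s) z y

/-- The transition function `P_t(x,y)` of the pure jump Markov process with transition intensities
`q`: the increasing limit of Feller's iteration started from `0`, i.e. the minimal nonnegative
solution of the backward equation. The `k`-th iterate is the probability of being at `y` at time
`t` after fewer than `k` jumps. -/
def transition {E : Type*} [DecidableEq E] (q : E → E → ℝ) (t : ℝ) (x y : E) : ℝ :=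
  (⨆ k : ℕ, ((fellerStep q)^[k] (fun _ _ _ => 0)) t x y).toReal

/-- The action `P_t f(x) = ∑_y P_t(x,y) f(y)` of a transition function on functions. -/
def act {E : Type*} (P : ℝ → E → E → ℝ) (t : ℝ) (f : E → ℝ) : E → ℝ :=
  fun x => ∑' y, P t x y * f y

/-- `f ∈ L²(E, π)`. -/
def MemL2 {E : Type*} (π : E → ℝ) (f : E → ℝ) : Prop := Summable fun x => f x ^ 2 * π x

/-- `⟨f, g⟩_π = ∑_x f(x) g(x) π(x)`. -/
def scal {E : Type*} (π : E → ℝ) (f g : E → ℝ) : ℝ := ∑' x, f x * g x * π x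

/-- `‖f‖₂`. -/
def norm2 {E : Type*} (π : E → ℝ) (f : E → ℝ) : ℝ := Real.sqrt (scal π f f)

/-- `π(f) = ⟨f, 1⟩_π`. -/
def mean {E : Type*} (π : E → ℝ) (f : E → ℝ) : ℝ := scal π f (fun _ => 1)

/-- `∑_y |p(y) - r(y)|`, as an extended nonnegative real. -/
def tvNorm {E : Type*} (p r : E → ℝ) : ℝ≥0∞ := ∑' y, ENNReal.ofReal |p y - r y|

/-- `π` is a stationary distribution of the transition function `P`. -/
def IsStationary {E : Type*} (P : ℝ → E → E → ℝ) (π : E → ℝ) : Prop :=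
  (∀ x, 0 ≤ π x) ∧ HasSum π 1 ∧ ∀ t, 0 ≤ t → ∀ y, HasSum (fun x => π x * P t x y) (π y)

/-- `f` belongs to the domain, in `L²(E, π)`, of the infinitesimal generator of the semigroup `P`,
the generator acting on `f` by the pointwise formula `Q`: the difference quotients
`(P_t f - f) / t` converge to `Q f` in `L²(E, π)` as `t ↓ 0`. -/
def InDomain {E : Type*} (π : E → ℝ) (P : ℝ → E → E → ℝ) (Q : (E → ℝ) → E → ℝ) (f : E → ℝ) :
    Prop :=
  MemL2 π f ∧ MemL2 π (Q f) ∧ (∀ t, 0 < t → MemL2 π (act P t f)) ∧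
    Filter.Tendsto (fun t : ℝ => norm2 π (fun x => (act P t f x - f x) / t - Q f x))
      (𝓝[>] 0) (𝓝 0)

/-- The spectral gap `inf {-⟨f, Q f⟩_π : ‖f‖₂ = 1, π(f) = 0}`, the infimum being over the domain
of the generator. -/
def gap {E : Type*} (π : E → ℝ) (P : ℝ → E → E → ℝ) (Q : (E → ℝ) → E → ℝ) : ℝ :=
  sInf {c | ∃ f, InDomain π P Q f ∧ norm2 π f = 1 ∧ mean π f = 0 ∧ c = -scal π f (Q f)}

end MarkovChain

/-! ### Strongly light-tailed distributions on the nonnegative integers -/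

/-- The discrete hazard function `h_p(k) = p(k) / ∑_{j ≥ k} p(j)`. -/
def hazard (p : ℕ → ℝ) (k : ℕ) : ℝ := p k / ∑' j, p (k + j)

/-- `p` is a probability distribution charging every integer, whose hazard function is bounded
away from zero. -/
def StronglyLightTailed (p : ℕ → ℝ) : Prop :=
  (∀ k, 0 < p k) ∧ HasSum p 1 ∧ 0 < ⨅ k, hazard p k

/-! ### Unreliable Jackson networks -/

/-- The parameters of an unreliable Jackson network with `m` nodes. The index `none` is the
outside node `0`, and `some i` is the node `i`. -/
structure JacksonNetwork (m : ℕ) where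
  /-- external arrival intensity -/
  lam : ℝ
  /-- routing probabilities on the set of nodes together with the outside -/
  r : Matrix (Option (Fin m)) (Option (Fin m)) ℝ
  /-- service intensities -/
  mu : Fin m → ℕ → ℝ
  /-- the function governing breakdowns -/
  psi : Finset (Fin m) → ℝ
  /-- the function governing repairs -/
  phi : Finset (Fin m) → ℝ
  lam_pos : 0 < lam
  r_nonneg : ∀ i j, 0 ≤ r i j
  r_sum : ∀ i, ∑ j, r i j = 1
  mu_zero : ∀ i, mu i 0 = 0
  mu_lower : ∀ i, ∃ c, 0 < c ∧ ∀ n, 1 ≤ n → c ≤ mu i n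
  psi_pos : ∀ D, 0 < psi D
  phi_pos : ∀ D, 0 < phi D

namespace JacksonNetwork

/-- States `(D, n₁, …, n_m)`: the set `D` of servers in down status and the queue lengths. -/
abbrev State (m : ℕ) : Type := Finset (Fin m) × (Fin m → ℕ)

/-- `n + e_j`. -/
def inc {m : ℕ} (j : Fin m) (n : Fin m → ℕ) : Fin m → ℕ := Function.update n j (n j + 1)

/-- `n - e_i` (only used with a rate that vanishes when `n i = 0`). -/
def dec {m : ℕ} (i : Fin m) (n : Fin m → ℕ) : Fin m → ℕ := Function.update n i (n i - 1)

variable {m : ℕ} (N : JacksonNetwork m)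

/-- The routing `r^D` of the repetitive service - random destination blocking rule; it vanishes
when one of the two nodes is down. -/
def blocked (D : Finset (Fin m)) (i j : Option (Fin m)) : ℝ :=
  if i ∈ D.image some ∨ j ∈ D.image some then 0
  else if i = j then N.r i i + ∑ k ∈ D, N.r i (some k)
  else N.r i j

/-- The infinitesimal generator: external arrivals, migrations, breakdowns of a set `I` of servers
in up status, repairs of a set `H` of servers in down status, and departures. -/
def gen (f : State m → ℝ) (x : State m) : ℝ :=
  (∑ j, (f (x.1, inc j x.2) - f x) * (N.lam * N.blocked x.1 none (some j))) +
  (∑ i, ∑ j, (f (x.1, inc j (dec i x.2)) - f x) *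
    (N.mu i (x.2 i) * N.blocked x.1 (some i) (some j))) +
  (∑ I ∈ x.1ᶜ.powerset, (f (x.1 ∪ I, x.2) - f x) * (N.psi (x.1 ∪ I) / N.psi x.1)) +
  (∑ H ∈ x.1.powerset, (f (x.1 \ H, x.2) - f x) * (N.phi x.1 / N.phi (x.1 \ H))) +
  (∑ j, (f (x.1, dec j x.2) - f x) * (N.mu j (x.2 j) * N.blocked x.1 (some j) none))

/-- The matrix of transition intensities: the matrix of the operator `gen`. -/
def q (x y : State m) : ℝ := N.gen (Pi.single y 1) x

/-- The transition function of the unreliable Jackson network. -/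
def P : ℝ → State m → State m → ℝ := MarkovChain.transition N.q

/-- `L` solves the traffic equation. -/
def IsTraffic (L : Fin m → ℝ) : Prop :=
  ∀ i, L i = N.lam * N.r none (some i) + ∑ j, L j * N.r (some j) (some i)

/-- The traffic vector extended to the outside node by the external arrival intensity. -/
def fullTraffic (L : Fin m → ℝ) : Option (Fin m) → ℝ
  | none => N.lam
  | some i => L i

/-- The routing is reversible with respect to the traffic vector. -/
def IsReversible (L : Fin m → ℝ) : Prop :=
  ∀ i j, N.fullTraffic L j * N.r j i = N.fullTraffic L i * N.r i j

/-- The routing matrix is regular: some power has only positive entries. -/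
def IsRegular : Prop := ∃ k : ℕ, 1 ≤ k ∧ ∀ i j, 0 < (N.r ^ k) i j

/-- `λ_i^n / ∏_{k=1}^n μ_i(k)`. -/
def weight (L : Fin m → ℝ) (i : Fin m) (n : ℕ) : ℝ :=
  L i ^ n / ∏ k ∈ Finset.Icc 1 n, N.mu i k

/-- The marginal `π_i`. -/
def marginal (L : Fin m → ℝ) (i : Fin m) (n : ℕ) : ℝ :=
  N.weight L i n / ∑' k, N.weight L i k

/-- The product form distribution
`π(D, n₁, …, n_m) = C⁻¹ (ψ(D) / φ(D)) ∏_i π_i(n_i)`, `C = ∑_D ψ(D) / φ(D)`. -/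
def stat (L : Fin m → ℝ) (x : State m) : ℝ :=
  (N.psi x.1 / N.phi x.1) / (∑ D, N.psi D / N.phi D) * ∏ i, N.marginal L i (x.2 i)

/-- The spectral gap of the unreliable Jackson network. -/
def spectralGap (L : Fin m → ℝ) : ℝ := MarkovChain.gap (N.stat L) N.P N.gen

end JacksonNetwork

end

/-! The product measure is in detailed balance. The RS-RD rule alters only diagonal routing entries
and erases rows and columns symmetrically, so reversibility of the routing survives every pattern of
breakdowns, and each move has a reverse move carrying the same stationary flow
(`JacksonNetwork.isReversibleMoves`).

Service rates may be unbounded, so the minimal process has to be studied from its construction.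
Feller's iteration is decomposed by the number of jumps. Comparing first-jump with last-jump
recursions gives reversibility, and explosion is excluded because the expected number of jumps in
bounded time under stationarity is finite (`MarkovChain.minimal_mass`). The outcome is a strongly
continuous contraction semigroup on L², realised on `ℓ²`.

Decay needs no spectral theorem. With `g` the gap and `f` of mean zero in the domain, `e^{2gt} ‖P_t
f‖²` has nonpositive right derivative; time averages approximate every mean-zero vector by such `f`
(`ContractionSemigroup.norm_le_exp`). This is (i), and (ii) is (i) applied to the density of a point
mass with respect to `π`, followed by Cauchy–Schwarz (`exists_tvNorm_le`).

The heart is positivity of the gap, that is, the Poincaré inequality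
`JacksonNetwork.exists_poincare`. The variance is dominated by the second moment about the value at
one state, the empty network with all servers up. Every state is joined to that one by repairing all
servers at once and then emptying the queues one after another, and each stage is bounded in mean
square by the Dirichlet form. Emptying a queue reduces, by a one-dimensional Hardy inequality
(`StronglyLightTailed.exists_hardy`, the place where the hazard bound enters), to adding one
customer to it. Direct arrivals at that node may be impossible, so the customer is routed from
outside along a path of positive routing probabilities, which regularity supplies
(`controlled_addTo`). Finally `sum_dirichlet_le` bounds the Dirichlet form by the quadratic form of
the L² generator. -/

noncomputable section

section

open MeasureTheory Set

/-! ### Convolution on the half-line -/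

namespace MarkovChain

/-- Convolution on the positive half-line. -/
def conv (f g : ℝ → ℝ≥0∞) (t : ℝ) : ℝ≥0∞ := ∫⁻ s in Ioc 0 t, f s * g (t - s)

/-- Identifying the half-line convolution with one on the whole line makes commutativity and
associativity available. The endpoint `s = t`, lost by the second indicator, is a null set. -/
theorem conv_eq_lconvolution (f g : ℝ → ℝ≥0∞) :
    conv f g = lconvolution ((Ioi 0).indicator f) ((Ioi 0).indicator g) volume := by
  funext t
  rw [lconvolution_def, conv, ← restrict_Ioo_eq_restrict_Ioc, ← lintegral_indicator measurableSet_Ioo]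
  congr 1
  funext s
  simp only [indicator, mem_Ioo, mem_Ioi]
  by_cases h1 : 0 < s <;> by_cases h2 : s < t
  · have : 0 < -s + t := by linarith
    simp [h1, h2, this, sub_eq_neg_add]
  · have : ¬ 0 < -s + t := by linarith
    simp [h1, h2, this]
  · simp [h1]
  · simp [h1]

theorem indicator_conv (f g : ℝ → ℝ≥0∞) : (Ioi 0).indicator (conv f g) = conv f g := by
  funext t
  by_cases h : 0 < t
  · simp [h]
  · simp [h, conv]

theorem conv_comm (f g : ℝ → ℝ≥0∞) : conv f g = conv g f := by
  rw [conv_eq_lconvolution, lconvolution_comm, ← conv_eq_lconvolution]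

theorem measurable_conv {f g : ℝ → ℝ≥0∞} (hf : Measurable f) (hg : Measurable g) :
    Measurable (conv f g) := by
  rw [conv_eq_lconvolution]
  exact measurable_lconvolution _ (hf.indicator measurableSet_Ioi) (hg.indicator measurableSet_Ioi)

theorem conv_assoc {f g k : ℝ → ℝ≥0∞} (hf : Measurable f) (hg : Measurable g)
    (hk : Measurable k) : conv f (conv g k) = conv (conv f g) k := by
  rw [conv_eq_lconvolution, conv_eq_lconvolution (conv f g), indicator_conv, indicator_conv,
    conv_eq_lconvolution, conv_eq_lconvolution]
  exact lconvolution_assoc (hf.indicator measurableSet_Ioi) (hg.indicator measurableSet_Ioi)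
    (hk.indicator measurableSet_Ioi)

theorem conv_tsum {ι : Type*} [Countable ι] {f : ℝ → ℝ≥0∞} (hf : Measurable f)
    {g : ι → ℝ → ℝ≥0∞} (hg : ∀ i, Measurable (g i)) (t : ℝ) :
    conv f (fun s => ∑' i, g i s) t = ∑' i, conv f (g i) t := by
  simp only [conv, ← ENNReal.tsum_mul_left]
  rw [lintegral_tsum]
  intro i
  have := hg i
  fun_prop

theorem tsum_conv {ι : Type*} [Countable ι] {g : ℝ → ℝ≥0∞} (hg : Measurable g)
    {f : ι → ℝ → ℝ≥0∞} (hf : ∀ i, Measurable (f i)) (t : ℝ) :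
    conv (fun s => ∑' i, f i s) g t = ∑' i, conv (f i) g t := by
  rw [conv_comm, conv_tsum hg hf]
  simp only [conv_comm]

theorem conv_const_mul {f g : ℝ → ℝ≥0∞} (hf : Measurable f) (hg : Measurable g) (c : ℝ≥0∞)
    (t : ℝ) : conv f (fun s => c * g s) t = c * conv f g t := by
  rw [conv, conv, ← lintegral_const_mul _ (by fun_prop)]
  congr 1; funext s; ring

theorem conv_const_mul_left {f g : ℝ → ℝ≥0∞} (hf : Measurable f) (hg : Measurable g) (c : ℝ≥0∞)
    (t : ℝ) : conv (fun s => c * f s) g t = c * conv f g t := by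
  rw [conv_comm, conv_const_mul hg hf, conv_comm]

theorem conv_add {f g k : ℝ → ℝ≥0∞} (hf : Measurable f) (hg : Measurable g) (t : ℝ) :
    conv f (fun s => g s + k s) t = conv f g t + conv f k t := by
  simp only [conv, mul_add]
  rw [lintegral_add_left (by fun_prop)]

theorem conv_finset_sum {ι : Type*} (S : Finset ι) {f : ℝ → ℝ≥0∞} (hf : Measurable f)
    {g : ι → ℝ → ℝ≥0∞} (hg : ∀ i, Measurable (g i)) (t : ℝ) :
    conv f (fun s => ∑ i ∈ S, g i s) t = ∑ i ∈ S, conv f (g i) t := by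
  simp only [conv, Finset.mul_sum]
  rw [lintegral_finsetSum]
  intro i _
  have := hg i
  fun_prop

theorem conv_congr {f f' g g' : ℝ → ℝ≥0∞} (hf : ∀ s, 0 ≤ s → f s = f' s)
    (hg : ∀ s, 0 ≤ s → g s = g' s) (t : ℝ) : conv f g t = conv f' g' t := by
  refine setLIntegral_congr_fun measurableSet_Ioc fun s hs => ?_
  simp only [hf s hs.1.le, hg (t - s) (by linarith [hs.2])]

/-- A convolution up to time `t + s`, split at time `t`. -/
theorem conv_add_time (f g : ℝ → ℝ≥0∞) {t s : ℝ} (ht : 0 ≤ t) (hs : 0 ≤ s) :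
    conv f g (t + s) = conv f (fun u => g (u + s)) t + conv (fun u => f (t + u)) g s := by
  have hsplit : Ioc 0 (t + s) = Ioc 0 t ∪ Ioc t (t + s) :=
    (Ioc_union_Ioc_eq_Ioc ht (by linarith)).symm
  rw [conv, hsplit, lintegral_union measurableSet_Ioc
    (Set.disjoint_left.2 fun x hx hx' => absurd hx.2 (not_le.2 hx'.1))]
  congr 1
  · rw [conv]
    congr 1; funext u; congr 2; ring
  · rw [conv, ← lintegral_indicator measurableSet_Ioc, ← lintegral_indicator measurableSet_Ioc,
      ← lintegral_add_left_eq_self _ t]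
    congr 1; funext u
    simp only [indicator, mem_Ioc]
    by_cases h : 0 < u ∧ u ≤ s
    · rw [if_pos ⟨by linarith, by linarith⟩, if_pos h]
      congr 2; ring
    · rw [if_neg (fun h' => h ⟨by linarith, by linarith⟩), if_neg h]

/-! ### The decomposition of the minimal transition function by the number of jumps -/

variable {E : Type*} [DecidableEq E]

/-- The off-diagonal intensities. -/
def offRate (q : E → E → ℝ) (x z : E) : ℝ≥0∞ := if z = x then 0 else ENNReal.ofReal (q x z)

/-- The probability of having not left `x` at time `t`. -/
def holding (q : E → E → ℝ) (x : E) (t : ℝ) : ℝ≥0∞ := ENNReal.ofReal (Real.exp (q x x * t))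

/-- The probability of being at `y` at time `t` after exactly `n` jumps. -/
def jumps (q : E → E → ℝ) : ℕ → ℝ → E → E → ℝ≥0∞
  | 0, t, x, y => if x = y then holding q x t else 0
  | n + 1, t, x, y => ∑' z, offRate q x z * conv (holding q x) (fun s => jumps q n s z y) t

section Holding

omit [DecidableEq E]

@[fun_prop]
theorem measurable_holding (q : E → E → ℝ) (x : E) : Measurable (holding q x) := by
  unfold holding; fun_prop

theorem holding_add (q : E → E → ℝ) (x : E) (t s : ℝ) :
    holding q x (t + s) = holding q x t * holding q x s := by
  rw [holding, holding, holding, ← ENNReal.ofReal_mul (Real.exp_pos _).le, ← Real.exp_add, mul_add]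

theorem holding_add_conv (q : E → E → ℝ) (x : E) (hq : q x x ≤ 0) {t : ℝ} (ht : 0 ≤ t) :
    holding q x t + ENNReal.ofReal (-q x x) * conv (holding q x) (fun _ => 1) t = 1 := by
  have hint : ∫ s in (0 : ℝ)..t, -q x x * Real.exp (q x x * s) = 1 - Real.exp (q x x * t) := by
    have := intervalIntegral.integral_eq_sub_of_hasDerivAt
      (f := fun s => -Real.exp (q x x * s)) (f' := fun s => -q x x * Real.exp (q x x * s))
      (a := 0) (b := t) (fun s _ => by
        have h := (((hasDerivAt_id' s).const_mul (q x x)).exp).fun_neg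
        convert h using 1
        ring) (Continuous.intervalIntegrable (by fun_prop) _ _)
    rw [this]; simp; ring
  have hle : Real.exp (q x x * t) ≤ 1 :=
    Real.exp_le_one_iff.2 (mul_nonpos_of_nonpos_of_nonneg hq ht)
  have : ENNReal.ofReal (-q x x) * conv (holding q x) (fun _ => 1) t =
      ENNReal.ofReal (1 - Real.exp (q x x * t)) := by
    rw [← hint, intervalIntegral.integral_of_le ht, ofReal_integral_eq_lintegral_ofReal]
    · simp only [conv, mul_one]
      rw [← lintegral_const_mul _ (by fun_prop)]
      congr 1; funext s
      rw [holding, ENNReal.ofReal_mul (by linarith)]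
    · exact (Continuous.intervalIntegrable (by fun_prop) _ _).1
    · exact Filter.Eventually.of_forall fun s =>
        mul_nonneg (by linarith) (Real.exp_pos _).le
  rw [this, holding, ← ENNReal.ofReal_add (Real.exp_pos _).le (by linarith)]
  simp

end Holding

variable [Countable E] (q : E → E → ℝ)

@[fun_prop]
theorem measurable_jumps (n : ℕ) (x y : E) : Measurable fun t => jumps q n t x y := by
  induction n generalizing x y with
  | zero => simp only [jumps]; split_ifs <;> fun_prop
  | succ n ih =>
    simp only [jumps]
    exact Measurable.tsum fun z =>
      (measurable_conv (measurable_holding q x) (ih z y)).const_mul _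

theorem fellerStep_iterate (k : ℕ) :
    (fellerStep q)^[k] (fun _ _ _ => 0) = fun t x y => ∑ j ∈ Finset.range k, jumps q j t x y := by
  induction k with
  | zero => simp
  | succ k ih =>
    rw [Function.iterate_succ_apply', ih]
    funext t x y
    have hm : ∀ z, Measurable fun s => ∑ j ∈ Finset.range k, jumps q j s z y := fun z =>
      Finset.measurable_fun_sum _ fun j _ => measurable_jumps q j z y
    rw [Finset.sum_range_succ', add_comm, fellerStep]
    congr 1
    simp only [jumps]
    rw [← Summable.tsum_finsetSum (fun _ _ => ENNReal.summable)]
    have hfun : ∀ s, (ENNReal.ofReal (Real.exp (q x x * s)) *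
        ∑' z, if z = x then 0 else ENNReal.ofReal (q x z) *
          ∑ j ∈ Finset.range k, jumps q j (t - s) z y) =
        holding q x s * ∑' z, offRate q x z * ∑ j ∈ Finset.range k, jumps q j (t - s) z y := by
      intro s
      rw [holding]
      congr 2; funext z
      by_cases h : z = x <;> simp [h, offRate]
    simp only [hfun]
    refine (conv_tsum (measurable_holding q x)
      (g := fun z s => offRate q x z * ∑ j ∈ Finset.range k, jumps q j s z y)
      (fun z => (hm z).const_mul _) t).trans ?_
    congr 1; funext z
    rw [conv_const_mul (measurable_holding q x) (hm z), ← Finset.mul_sum]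
    rw [conv_finset_sum _ (measurable_holding q x) (fun j => measurable_jumps q j z y)]

/-- The weighted row sums of the jump decomposition satisfy the backward recursion. -/
theorem tsum_jumps_succ (n : ℕ) (t : ℝ) (x : E) (g : E → ℝ≥0∞) :
    ∑' y, jumps q (n + 1) t x y * g y =
      ∑' z, offRate q x z * conv (holding q x) (fun s => ∑' y, jumps q n s z y * g y) t := by
  simp only [jumps, ← ENNReal.tsum_mul_right]
  rw [ENNReal.tsum_comm]
  congr 1; funext z
  rw [conv_tsum (measurable_holding q x) (fun y => (measurable_jumps q n z y).mul_const _),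
    ← ENNReal.tsum_mul_left]
  congr 1; funext y
  simp only [mul_comm _ (g y)]
  rw [conv_const_mul (measurable_holding q x) (measurable_jumps q n z y)]
  ring

omit [Countable E] in
theorem tsum_jumps_zero (t : ℝ) (x : E) (g : E → ℝ≥0∞) :
    ∑' y, jumps q 0 t x y * g y = holding q x t * g x := by
  rw [tsum_eq_single x]
  · simp [jumps]
  · intro y hy; simp [jumps, hy.symm]

theorem measurable_tsum_jumps (n : ℕ) (x : E) (g : E → ℝ≥0∞) :
    Measurable fun t => ∑' y, jumps q n t x y * g y :=
  Measurable.tsum fun y => (measurable_jumps q n x y).mul_const _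

/-- Chapman–Kolmogorov, refined by how many of the `n` jumps occur before time `t`. In the induction
the first jump falls either before or after `t`; the second case is the antidiagonal term with no
jump before `t`. -/
theorem jumps_add (n : ℕ) {t s : ℝ} (ht : 0 ≤ t) (hs : 0 ≤ s) (x y : E) :
    jumps q n (t + s) x y =
      ∑ p ∈ Finset.HasAntidiagonal.antidiagonal n, ∑' z, jumps q p.1 t x z * jumps q p.2 s z y := by
  induction n generalizing t x y with
  | zero =>
    rw [Finset.Nat.antidiagonal_zero, Finset.sum_singleton]
    rw [tsum_jumps_zero]
    simp only [jumps, holding_add]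
    split_ifs <;> simp
  | succ n ih =>
    rw [Finset.Nat.sum_antidiagonal_succ, tsum_jumps_zero]
    have h1 : ∀ w, conv (holding q x) (fun u => jumps q n u w y) (t + s) =
        (∑ p ∈ Finset.HasAntidiagonal.antidiagonal n, ∑' z,
          conv (holding q x) (fun u => jumps q p.1 u w z) t * jumps q p.2 s z y) +
        holding q x t * conv (holding q x) (fun u => jumps q n u w y) s := by
      intro w
      rw [conv_add_time _ _ ht hs]
      congr 1
      · rw [conv_congr (fun _ _ => rfl) (fun u hu => ih hu w y)]
        rw [conv_finset_sum _ (measurable_holding q x)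
          (g := fun (p : ℕ × ℕ) u => ∑' z, jumps q p.1 u w z * jumps q p.2 s z y)
          (fun p => measurable_tsum_jumps q p.1 w (fun z => jumps q p.2 s z y))]
        refine Finset.sum_congr rfl fun p _ => ?_
        rw [conv_tsum (measurable_holding q x) (fun z => (measurable_jumps q _ w z).mul_const _)]
        congr 1; funext z
        simp only [mul_comm _ (jumps q p.2 s z y)]
        rw [conv_const_mul (measurable_holding q x) (measurable_jumps q _ w z)]
      · simp only [holding_add]
        rw [conv_const_mul_left (measurable_holding q x) (measurable_jumps q n w y)]
    have h2 : jumps q (n + 1) (t + s) x y = ∑' z, offRate q x z *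
        conv (holding q x) (fun u => jumps q n u z y) (t + s) := rfl
    rw [h2]
    simp only [h1, mul_add]
    rw [ENNReal.tsum_add, add_comm]
    congr 1
    · rw [jumps, ← ENNReal.tsum_mul_left]
      congr 1; funext z; ring
    · simp only [Finset.mul_sum, jumps, ← ENNReal.tsum_mul_left, ← ENNReal.tsum_mul_right]
      rw [Summable.tsum_finsetSum (fun _ _ => ENNReal.summable)]
      refine Finset.sum_congr rfl fun p _ => ?_
      rw [ENNReal.tsum_comm]
      simp only [mul_assoc]

/-- Last-jump decomposition, obtained from the first-jump recursion by associativity of convolution.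
It is the mirror image needed for time reversal. -/
theorem jumps_succ_forward (n : ℕ) (t : ℝ) (x y : E) :
    jumps q (n + 1) t x y =
      ∑' z, conv (fun s => jumps q n s x z) (holding q y) t * offRate q z y := by
  induction n generalizing t x y with
  | zero =>
    rw [jumps, tsum_eq_single y, tsum_eq_single x]
    · simp [jumps, mul_comm]
    · intro z hz; simp [jumps, hz.symm, conv]
    · intro z hz; simp [jumps, hz, conv]
  | succ n ih =>
    rw [jumps]
    have h1 : ∀ w, conv (holding q x) (fun s => jumps q (n + 1) s w y) t =
        ∑' z, conv (conv (holding q x) (fun s => jumps q n s w z)) (holding q y) t *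
          offRate q z y := by
      intro w
      simp only [ih _ w y]
      have hm : ∀ z, Measurable (conv (fun s => jumps q n s w z) (holding q y)) := fun z =>
        measurable_conv (measurable_jumps q n w z) (measurable_holding q y)
      rw [conv_tsum (measurable_holding q x) (fun z => (hm z).mul_const _)]
      congr 1; funext z
      simp only [mul_comm _ (offRate q z y)]
      rw [conv_const_mul (measurable_holding q x) (hm z),
        conv_assoc (measurable_holding q x) (measurable_jumps q n w z) (measurable_holding q y)]
    simp only [h1, ← ENNReal.tsum_mul_left]
    rw [ENNReal.tsum_comm]
    congr 1; funext z
    have hm : ∀ w, Measurable (conv (holding q x) (fun s => jumps q n s w z)) := fun w =>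
      measurable_conv (measurable_holding q x) (measurable_jumps q n w z)
    simp only [jumps]
    rw [tsum_conv (measurable_holding q y) (fun w => (hm w).const_mul _),
      ← ENNReal.tsum_mul_right]
    congr 1; funext w
    rw [conv_const_mul_left (hm w) (measurable_holding q y)]
    ring

/-- Detailed balance turns the first-jump recursion from `x` into the last-jump recursion towards
`x`, term by term in the neighbour of `x`. -/
theorem jumps_symm {w : E → ℝ≥0∞} (hrev : ∀ x y, w x * offRate q x y = w y * offRate q y x)
    (n : ℕ) (t : ℝ) (x y : E) : w x * jumps q n t x y = w y * jumps q n t y x := by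
  induction n generalizing t x y with
  | zero =>
    by_cases h : x = y
    · subst h; rfl
    · simp [jumps, h, Ne.symm h]
  | succ n ih =>
    rw [jumps_succ_forward q n t y x, jumps, ← ENNReal.tsum_mul_left, ← ENNReal.tsum_mul_left]
    congr 1; funext z
    rw [← mul_assoc, hrev, mul_right_comm, ← mul_assoc,
      ← conv_const_mul_left (measurable_jumps q n y z) (measurable_holding q x), conv_comm]
    simp only [← ih _ z y]
    rw [conv_const_mul_left (measurable_jumps q n z y) (measurable_holding q x)]

/-! ### Mass balance, the minimal transition function and non-explosion -/

variable (hq : ∀ x, q x x ≤ 0) (hc : ∀ x, ∑' z, offRate q x z = ENNReal.ofReal (-q x x))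

include hq hc in
-- Either at most `k` jumps have occurred by time `t`, or the jump number `k + 1` has; the
-- convolution integrates the flow out of the states reached after `k` jumps.
theorem jumps_mass (k : ℕ) {t : ℝ} (ht : 0 ≤ t) (x : E) :
    ∑ j ∈ Finset.range (k + 1), ∑' y, jumps q j t x y * 1 +
      conv (fun _ => 1) (fun s => ∑' y, jumps q k s x y * ENNReal.ofReal (-q y y)) t = 1 := by
  induction k generalizing t x with
  | zero =>
    rw [Finset.sum_range_one]
    simp only [tsum_jumps_zero, mul_comm (holding q x _), one_mul]
    rw [conv_const_mul measurable_const (measurable_holding q x), conv_comm,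
      holding_add_conv q x (hq x) ht]
  | succ k ih =>
    have hM : ∀ j z, Measurable fun s => ∑' y, jumps q j s z y * 1 := fun j z =>
      measurable_tsum_jumps q j z _
    have hB : ∀ z, Measurable fun s => ∑' y, jumps q k s z y * ENNReal.ofReal (-q y y) := fun z =>
      measurable_tsum_jumps q k z _
    rw [Finset.sum_range_succ', tsum_jumps_zero, mul_one]
    simp only [tsum_jumps_succ]
    rw [← Summable.tsum_finsetSum (fun _ _ => ENNReal.summable),
      conv_tsum measurable_const
        (fun z => (measurable_conv (measurable_holding q x) (hB z)).const_mul _), add_right_comm,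
      ← ENNReal.tsum_add]
    refine Eq.trans ?_ (holding_add_conv q x (hq x) ht)
    -- Conservativity spreads the exit rate over the targets `z`, so the identity can be checked for
    -- each first jump separately, where it is the induction hypothesis.
    rw [add_comm, ← hc, ← ENNReal.tsum_mul_right]
    congr 2; funext z
    rw [conv_const_mul measurable_const (measurable_conv (measurable_holding q x) (hB z)),
      ← Finset.mul_sum, ← mul_add, conv_assoc measurable_const (measurable_holding q x) (hB z),
      conv_comm (fun _ => 1) (holding q x),
      ← conv_assoc (measurable_holding q x) measurable_const (hB z)]
    congr 1
    rw [← conv_congr (fun _ _ => rfl) (fun s hs => ih hs z),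
      conv_add (measurable_holding q x) (Finset.measurable_fun_sum _ fun j _ => hM j z)]
    rw [conv_finset_sum _ (measurable_holding q x) (fun j => hM j z)]

/-- The minimal transition function, with values in the extended nonnegative reals. -/
def minimal (q : E → E → ℝ) (t : ℝ) (x y : E) : ℝ≥0∞ := ∑' n, jumps q n t x y

theorem transition_eq (t : ℝ) (x y : E) : transition q t x y = (minimal q t x y).toReal := by
  rw [transition, minimal, ENNReal.tsum_eq_iSup_nat]
  simp only [fellerStep_iterate]

omit [Countable E] in
theorem minimal_zero (x y : E) : minimal q 0 x y = if x = y then 1 else 0 := by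
  rw [minimal, tsum_eq_single 0]
  · simp [jumps, holding]
  · intro n hn
    obtain ⟨n, rfl⟩ := Nat.exists_eq_succ_of_ne_zero hn
    simp [jumps, conv]

omit [Countable E] in
theorem holding_le_minimal (t : ℝ) (x : E) : holding q x t ≤ minimal q t x x := by
  refine le_trans ?_ (ENNReal.le_tsum 0)
  simp [jumps]

/-- A Cauchy product: pairs of jump numbers are regrouped by their sum. -/
theorem minimal_add {t s : ℝ} (ht : 0 ≤ t) (hs : 0 ≤ s) (x y : E) :
    minimal q (t + s) x y = ∑' z, minimal q t x z * minimal q s z y := by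
  simp only [minimal, jumps_add q _ ht hs]
  have h1 : ∀ z, (∑' n, jumps q n t x z) * (∑' n, jumps q n s z y) =
      ∑' n, ∑ p ∈ Finset.HasAntidiagonal.antidiagonal n, jumps q p.1 t x z * jumps q p.2 s z y := by
    intro z
    simp only [← ENNReal.tsum_mul_left, ← ENNReal.tsum_mul_right]
    rw [ENNReal.tsum_comm, ← ENNReal.tsum_prod (f := fun a b => jumps q a t x z * jumps q b s z y),
      ← (Finset.HasAntidiagonal.sigmaAntidiagonalEquivProd (A := ℕ)).tsum_eq, ENNReal.tsum_sigma']
    congr 1; funext n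
    rw [tsum_fintype, ← Finset.sum_coe_sort (Finset.HasAntidiagonal.antidiagonal n)]
    rfl
  simp only [h1]
  rw [ENNReal.tsum_comm]
  congr 1; funext n
  rw [Summable.tsum_finsetSum (fun _ _ => ENNReal.summable)]

theorem minimal_symm {w : E → ℝ≥0∞} (hrev : ∀ x y, w x * offRate q x y = w y * offRate q y x)
    (t : ℝ) (x y : E) : w x * minimal q t x y = w y * minimal q t y x := by
  simp only [minimal, ← ENNReal.tsum_mul_left, jumps_symm q hrev]

theorem minimal_backward (t : ℝ) (x : E) (g : E → ℝ≥0∞) :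
    ∑' y, minimal q t x y * g y = holding q x t * g x +
      ∑' z, offRate q x z * conv (holding q x) (fun s => ∑' y, minimal q s z y * g y) t := by
  have hsum : ∀ s z, ∑' y, minimal q s z y * g y = ∑' n, ∑' y, jumps q n s z y * g y := by
    intro s z
    simp only [minimal, ← ENNReal.tsum_mul_right]
    rw [ENNReal.tsum_comm]
  simp only [hsum]
  rw [tsum_eq_zero_add' ENNReal.summable, tsum_jumps_zero]
  congr 1
  simp only [tsum_jumps_succ]
  rw [ENNReal.tsum_comm]
  congr 1; funext z
  rw [conv_tsum (measurable_holding q x) (fun n => measurable_tsum_jumps q n z g),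
    ENNReal.tsum_mul_left]

include hq hc in
theorem tsum_jumps_le_one {t : ℝ} (ht : 0 ≤ t) (x : E) : ∑' n, ∑' y, jumps q n t x y ≤ 1 := by
  rw [ENNReal.tsum_eq_iSup_nat]
  refine iSup_le fun k => ?_
  refine le_trans ?_ (jumps_mass q hq hc k ht x).le
  simp only [mul_one]
  exact le_trans (Finset.sum_le_sum_of_subset (Finset.range_mono (Nat.le_succ k))) le_self_add

include hq hc in
/-- A reversible chain whose exit rate is integrable does not explode. -/
theorem minimal_mass {w : E → ℝ≥0∞} (hw : ∀ x, w x ≠ 0)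
    (hrev : ∀ x y, w x * offRate q x y = w y * offRate q y x)
    (hfin : ∑' x, w x * ENNReal.ofReal (-q x x) ≠ ∞) {t : ℝ} (ht : 0 ≤ t) (x : E) :
    ∑' y, minimal q t x y = 1 := by
  set R : ℕ → E → ℝ≥0∞ := fun k x =>
    conv (fun _ => 1) (fun s => ∑' y, jumps q k s x y * ENNReal.ofReal (-q y y)) t with hR
  have hB : ∀ k z, Measurable fun s => ∑' y, jumps q k s z y * ENNReal.ofReal (-q y y) :=
    fun k z => measurable_tsum_jumps q k z _
  -- `R k x` is the probability of more than `k` jumps by time `t` from `x`, so the left side is the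
  -- expected number of jumps under `w`. By reversibility the sum over starting points becomes a row
  -- sum from `y`, at most one, which leaves `t` times the mean exit rate.
  have htot : ∑' k, ∑' x, w x * R k x ≤
      conv (fun _ => 1) (fun _ => ∑' x, w x * ENNReal.ofReal (-q x x)) t := by
    have h1 : ∀ k, ∑' x, w x * R k x = conv (fun _ => 1)
        (fun s => ∑' x, w x * ∑' y, jumps q k s x y * ENNReal.ofReal (-q y y)) t := by
      intro k
      rw [conv_tsum measurable_const (fun x => (hB k x).const_mul _)]
      congr 1; funext x
      rw [conv_const_mul measurable_const (hB k x)]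
    simp only [h1]
    rw [← conv_tsum measurable_const
      (fun k => Measurable.tsum fun x => (hB k x).const_mul _)]
    refine setLIntegral_mono' measurableSet_Ioc fun s hs => ?_
    gcongr
    have hts : 0 ≤ t - s := by linarith [hs.2]
    calc ∑' k, ∑' x, w x * ∑' y, jumps q k (t - s) x y * ENNReal.ofReal (-q y y)
        = ∑' k, ∑' y, ∑' x, w y * ENNReal.ofReal (-q y y) * jumps q k (t - s) y x := by
          congr 1; funext k
          rw [ENNReal.tsum_comm]
          congr 1; funext x
          rw [← ENNReal.tsum_mul_left]
          congr 1; funext y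
          rw [← mul_assoc, jumps_symm q hrev]; ring
      _ = ∑' y, w y * ENNReal.ofReal (-q y y) * ∑' k, ∑' x, jumps q k (t - s) y x := by
          rw [ENNReal.tsum_comm]
          simp only [ENNReal.tsum_mul_left]
      _ ≤ ∑' y, w y * ENNReal.ofReal (-q y y) := by
          refine ENNReal.tsum_le_tsum fun y => ?_
          exact mul_le_of_le_one_right' (tsum_jumps_le_one q hq hc hts y)
  have hlt : ∑' k, w x * R k x ≠ ∞ := by
    refine ne_top_of_le_ne_top ?_ (le_trans (ENNReal.tsum_le_tsum fun k => ENNReal.le_tsum x) htot)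
    simp only [conv, one_mul, setLIntegral_const, Real.volume_Ioc]
    exact ENNReal.mul_ne_top hfin ENNReal.ofReal_ne_top
  rw [ENNReal.tsum_mul_left] at hlt
  have hRx : ∑' k, R k x ≠ ∞ := by
    intro h
    rw [h, ENNReal.mul_top (hw x)] at hlt
    exact hlt rfl
  -- Hence the defect of mass in `jumps_mass` vanishes as the number of jumps grows.
  have hR0 := ENNReal.tendsto_atTop_zero_of_tsum_ne_top hRx
  have hS : Filter.Tendsto (fun k => ∑ j ∈ Finset.range (k + 1), ∑' y, jumps q j t x y * 1)
      Filter.atTop (𝓝 (∑' j, ∑' y, jumps q j t x y * 1)) :=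
    (ENNReal.tendsto_nat_tsum _).comp (Filter.tendsto_add_atTop_nat 1)
  have hlim := hS.add hR0
  simp only [hR, jumps_mass q hq hc _ ht x, add_zero] at hlim
  have := tendsto_nhds_unique hlim tendsto_const_nhds
  simp only [mul_one] at this
  rw [← this, ENNReal.tsum_comm]
  rfl

end MarkovChain

end

namespace MarkovChain

open Filter Set

/-! ### Square-summable functions -/

section SquareSummable

variable {E : Type*} {π : E → ℝ}

theorem MemL2.mul (hπ : ∀ x, 0 < π x) {f g : E → ℝ} (hf : MemL2 π f) (hg : MemL2 π g) :
    Summable fun x => f x * g x * π x := by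
  refine Summable.of_norm_bounded (g := fun x => f x ^ 2 * π x + g x ^ 2 * π x)
    (Summable.add hf hg) fun x => ?_
  rw [Real.norm_eq_abs, abs_mul, abs_of_pos (hπ x), ← add_mul]
  refine mul_le_mul_of_nonneg_right ?_ (hπ x).le
  rw [abs_le]; constructor <;> nlinarith [sq_nonneg (f x + g x), sq_nonneg (f x - g x)]

theorem memL2_const (hs : Summable π) (c : ℝ) : MemL2 π fun _ => c := hs.mul_left _

theorem MemL2.const_mul {f : E → ℝ} (hf : MemL2 π f) (c : ℝ) : MemL2 π fun x => c * f x := by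
  refine (Summable.mul_left (c ^ 2) hf).congr fun x => ?_
  ring

theorem MemL2.of_abs_le {f g : E → ℝ} (hπ : ∀ x, 0 < π x) (hg : MemL2 π g)
    (h : ∀ x, |f x| ≤ |g x|) : MemL2 π f :=
  Summable.of_nonneg_of_le (fun x => mul_nonneg (sq_nonneg _) (hπ x).le)
    (fun x => mul_le_mul_of_nonneg_right (sq_le_sq.2 (h x)) (hπ x).le) hg

theorem MemL2.add (hπ : ∀ x, 0 < π x) {f g : E → ℝ} (hf : MemL2 π f) (hg : MemL2 π g) :
    MemL2 π fun x => f x + g x := by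
  refine ((Summable.add hf hg).add ((hf.mul hπ hg).mul_left 2)).congr fun x => ?_
  ring

theorem MemL2.sub (hπ : ∀ x, 0 < π x) {f g : E → ℝ} (hf : MemL2 π f) (hg : MemL2 π g) :
    MemL2 π fun x => f x - g x :=
  (hf.add hπ (hg.const_mul (-1))).congr fun x => by ring

theorem memL2_of_finite {f : E → ℝ} (hf : f.support.Finite) : MemL2 π f := by
  refine summable_of_hasFiniteSupport (hf.subset fun x hx => ?_)
  contrapose! hx
  simp_all

theorem MemL2.summable_mul (hπ : ∀ x, 0 < π x) (hs : Summable π) {f : E → ℝ} (hf : MemL2 π f) :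
    Summable fun x => f x * π x := by
  simpa using hf.mul hπ (memL2_const hs 1)

/-- The isomorphism of `ℓ²` with `L²(E, π)`. -/
def ofLp (π : E → ℝ) : lp (fun _ : E => ℝ) 2 →ₗ[ℝ] (E → ℝ) where
  toFun v x := v x / √(π x)
  map_add' u v := by funext x; simp [add_div]
  map_smul' c v := by funext x; simp [mul_div_assoc]

theorem ofLp_apply (v : lp (fun _ : E => ℝ) 2) (x : E) : ofLp π v x = v x / √(π x) := rfl

theorem memL2_ofLp (hπ : ∀ x, 0 < π x) (v : lp (fun _ : E => ℝ) 2) : MemL2 π (ofLp π v) := by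
  have h := (lp.memℓp v).summable (by norm_num)
  refine h.congr fun x => ?_
  rw [ofLp_apply, div_pow, Real.sq_sqrt (hπ x).le, div_mul_cancel₀ _ (hπ x).ne']
  simp

/-- The inverse of `ofLp`. -/
def toLp (hπ : ∀ x, 0 < π x) (f : E → ℝ) (hf : MemL2 π f) : lp (fun _ : E => ℝ) 2 :=
  ⟨fun x => f x * √(π x), memℓp_gen (by
    refine Summable.congr hf fun x => ?_
    simp [mul_pow, Real.sq_sqrt (hπ x).le])⟩

theorem toLp_apply (hπ : ∀ x, 0 < π x) (f : E → ℝ) (hf : MemL2 π f) (x : E) :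
    toLp hπ f hf x = f x * √(π x) := rfl

@[simp]
theorem ofLp_toLp (hπ : ∀ x, 0 < π x) (f : E → ℝ) (hf : MemL2 π f) :
    ofLp π (toLp hπ f hf) = f := by
  funext x
  rw [ofLp_apply, toLp_apply, mul_div_cancel_right₀ _ (Real.sqrt_pos.2 (hπ x)).ne']

theorem ofLp_injective (hπ : ∀ x, 0 < π x) : Function.Injective (ofLp π) := by
  intro u v h
  ext x
  have := congrFun h x
  rw [ofLp_apply, ofLp_apply, div_left_inj' (Real.sqrt_pos.2 (hπ x)).ne'] at this
  exact this

theorem inner_eq_scal (hπ : ∀ x, 0 < π x) (u v : lp (fun _ : E => ℝ) 2) :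
    inner ℝ u v = scal π (ofLp π u) (ofLp π v) := by
  rw [lp.inner_eq_tsum, scal]
  congr 1; funext x
  rw [ofLp_apply, ofLp_apply, div_mul_div_comm, Real.mul_self_sqrt (hπ x).le,
    div_mul_cancel₀ _ (hπ x).ne']
  simp [mul_comm]

theorem norm_eq_norm2 (hπ : ∀ x, 0 < π x) (v : lp (fun _ : E => ℝ) 2) :
    ‖v‖ = norm2 π (ofLp π v) := by
  rw [norm2, ← inner_eq_scal hπ, real_inner_self_eq_norm_sq, Real.sqrt_sq (norm_nonneg _)]

theorem continuous_ofLp (x : E) : Continuous fun v => ofLp π v x := by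
  have h : Continuous fun v : lp (fun _ : E => ℝ) 2 => (v : E → ℝ) x :=
    (LipschitzWith.of_dist_le_mul (K := 1) fun u v => by
      rw [dist_eq_norm, dist_eq_norm, NNReal.coe_one, one_mul]
      exact lp.norm_apply_le_norm (by norm_num) (u - v) x).continuous
  exact h.div_const _

end SquareSummable

/-! ### Reversible stochastic semigroups -/

/-- `P` is a conservative standard transition semigroup, reversible with respect to the positive
probability distribution `π`. -/
structure IsReversibleSemigroup {E : Type*} [DecidableEq E] (π : E → ℝ) (P : ℝ → E → E → ℝ) :
    Prop where
  pos : ∀ x, 0 < π x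
  sum : HasSum π 1
  nonneg : ∀ t x y, 0 ≤ P t x y
  mass : ∀ t, 0 ≤ t → ∀ x, HasSum (P t x) 1
  symm : ∀ t x y, π x * P t x y = π y * P t y x
  zero : ∀ x y, P 0 x y = if x = y then 1 else 0
  add : ∀ s t, 0 ≤ s → 0 ≤ t → ∀ x y, HasSum (fun z => P s x z * P t z y) (P (s + t) x y)
  diag : ∀ x, Tendsto (fun t => P t x x) (𝓝[>] 0) (𝓝 1)

namespace IsReversibleSemigroup

variable {E : Type*} [DecidableEq E] {π : E → ℝ} {P : ℝ → E → E → ℝ}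
  (hP : IsReversibleSemigroup π P) {t : ℝ} (ht : 0 ≤ t)

include hP

theorem isStationary : IsStationary P π := by
  refine ⟨fun x => (hP.pos x).le, hP.sum, fun t ht y => ?_⟩
  simp only [hP.symm t _ y]
  simpa using (hP.mass t ht y).mul_left (π y)

include ht

/-- The weights `π x * P t x y` are the joint law of the stationary chain at times `0` and `t`, with
both marginals equal to `π`. The L² contraction, preservation of the mean and the Dirichlet form
identity all come from summing against this law. -/
theorem hasSum_joint_left {g : E → ℝ} (hg : Summable fun x => g x * π x) :
    HasSum (fun p : E × E => π p.1 * P t p.1 p.2 * g p.1) (∑' x, g x * π x) := by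
  have h1 : ∀ x (c : ℝ), HasSum (fun y => π x * P t x y * c) (c * π x) := fun x c => by
    have := ((hP.mass t ht x).mul_left (π x)).mul_right c
    rwa [mul_one, mul_comm (π x) c] at this
  have hs : Summable fun p : E × E => π p.1 * P t p.1 p.2 * g p.1 := by
    refine Summable.of_norm ?_
    rw [summable_prod_of_nonneg (fun _ => norm_nonneg _)]
    have h2 : ∀ x, HasSum (fun y => ‖π x * P t x y * g x‖) (|g x| * π x) := fun x => by
      refine (h1 x |g x|).congr_fun ?_
      intro y
      simp [abs_of_pos (hP.pos x), abs_of_nonneg (hP.nonneg t x y)]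
    refine ⟨fun x => (h2 x).summable, ?_⟩
    simp only [(h2 _).tsum_eq]
    refine hg.norm.congr fun x => ?_
    simp [abs_of_pos (hP.pos x)]
  have h3 := hs.hasSum.prod_fiberwise fun x => h1 x (g x)
  rw [h3.tsum_eq]
  exact hs.hasSum

theorem hasSum_joint_right {g : E → ℝ} (hg : Summable fun x => g x * π x) :
    HasSum (fun p : E × E => π p.1 * P t p.1 p.2 * g p.2) (∑' x, g x * π x) := by
  have h := (Equiv.prodComm E E).hasSum_iff.2 (hP.hasSum_joint_left ht hg)
  refine h.congr_fun fun p => ?_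
  simp [hP.symm t p.1 p.2]

theorem summable_mul_sq {f : E → ℝ} (hf : MemL2 π f) (x : E) :
    Summable fun y => P t x y * f y ^ 2 := by
  have h := (hP.hasSum_joint_right ht (g := fun y => f y ^ 2) hf).summable.prod_factor x
  refine (h.mul_left (π x)⁻¹).congr fun y => ?_
  rw [mul_assoc, inv_mul_cancel_left₀ (hP.pos x).ne']

theorem summable_abs {f : E → ℝ} (hf : MemL2 π f) (x : E) :
    Summable fun y => P t x y * |f y| := by
  refine Summable.of_nonneg_of_le (fun y => mul_nonneg (hP.nonneg t x y) (abs_nonneg _))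
    (fun y => ?_) ((hP.mass t ht x).summable.add (hP.summable_mul_sq ht hf x))
  have : |f y| ≤ 1 + f y ^ 2 := by
    rw [← sq_abs]; nlinarith [sq_nonneg (|f y| - 1), abs_nonneg (f y)]
  nlinarith [hP.nonneg t x y, mul_le_mul_of_nonneg_left this (hP.nonneg t x y)]

theorem summable_mul {f : E → ℝ} (hf : MemL2 π f) (x : E) :
    Summable fun y => P t x y * f y := by
  refine Summable.of_norm ((hP.summable_abs ht hf x).congr fun y => ?_)
  simp [abs_of_nonneg (hP.nonneg t x y)]

/-- Jensen's inequality, in the form that the variance of `f` under the row `P t x` is nonnegative.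
-/
theorem act_sq_le {f : E → ℝ} (hf : MemL2 π f) (x : E) :
    act P t f x ^ 2 ≤ ∑' y, P t x y * f y ^ 2 := by
  have h1 := (hP.summable_mul ht hf x).hasSum
  have h2 := (hP.summable_mul_sq ht hf x).hasSum
  change HasSum _ (act P t f x) at h1
  have h3 := (h2.sub (h1.mul_left (2 * act P t f x))).add
    ((hP.mass t ht x).mul_left (act P t f x ^ 2))
  have h4 : 0 ≤ ∑' y, P t x y * f y ^ 2 - 2 * act P t f x * act P t f x +
      act P t f x ^ 2 * 1 := by
    refine h3.nonneg fun y => ?_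
    have := mul_nonneg (hP.nonneg t x y) (sq_nonneg (f y - act P t f x))
    nlinarith
  nlinarith

theorem hasSum_act_sq {f : E → ℝ} (hf : MemL2 π f) :
    HasSum (fun x => π x * ∑' y, P t x y * f y ^ 2) (scal π f f) := by
  have h := hP.hasSum_joint_right ht (g := fun y => f y ^ 2) hf
  have h2 := h.prod_fiberwise fun x => (h.summable.prod_factor x).hasSum
  simp only [mul_assoc, tsum_mul_left] at h2
  simpa only [scal, sq] using h2

theorem memL2_act {f : E → ℝ} (hf : MemL2 π f) : MemL2 π (act P t f) := by
  refine Summable.of_nonneg_of_le (fun x => mul_nonneg (sq_nonneg _) (hP.pos x).le) (fun x => ?_)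
    (hP.hasSum_act_sq ht hf).summable
  rw [mul_comm]
  exact mul_le_mul_of_nonneg_left (hP.act_sq_le ht hf x) (hP.pos x).le

theorem norm2_act_le {f : E → ℝ} (hf : MemL2 π f) : norm2 π (act P t f) ≤ norm2 π f := by
  refine Real.sqrt_le_sqrt ?_
  rw [← (hP.hasSum_act_sq ht hf).tsum_eq]
  refine Summable.tsum_le_tsum (fun x => ?_) ?_ (hP.hasSum_act_sq ht hf).summable
  · rw [mul_comm, ← sq]
    exact mul_le_mul_of_nonneg_left (hP.act_sq_le ht hf x) (hP.pos x).le
  · exact (hP.memL2_act ht hf).mul hP.pos (hP.memL2_act ht hf)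

theorem mean_act {f : E → ℝ} (hf : MemL2 π f) : mean π (act P t f) = mean π f := by
  have h := hP.hasSum_joint_right ht (hf.summable_mul hP.pos hP.sum.summable)
  have h2 := h.prod_fiberwise fun x => (h.summable.prod_factor x).hasSum
  simp only [mul_assoc, tsum_mul_left] at h2
  have h3 := h2.tsum_eq
  simp only [mean, scal, mul_one]
  rw [← h3]
  congr 1; funext x
  rw [mul_comm, act]

theorem act_add {f g : E → ℝ} (hf : MemL2 π f) (hg : MemL2 π g) :
    act P t (fun x => f x + g x) = fun x => act P t f x + act P t g x := by
  funext x
  simp only [act, mul_add]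
  exact (hP.summable_mul ht hf x).tsum_add (hP.summable_mul ht hg x)

theorem act_const (c : ℝ) : act P t (fun _ => c) = fun _ => c := by
  funext x
  simp only [act]
  rw [tsum_mul_right, (hP.mass t ht x).tsum_eq, one_mul]

theorem act_act {s : ℝ} (hs : 0 ≤ s) {f : E → ℝ} (hf : MemL2 π f) :
    act P s (act P t f) = act P (s + t) f := by
  funext x
  have hst : 0 ≤ s + t := add_nonneg hs ht
  have h1 : ∀ y (c : ℝ), HasSum (fun z => P s x z * P t z y * c) (P (s + t) x y * c) :=
    fun y c => (hP.add s t hs ht x y).mul_right c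
  -- Absolute summability over intermediate and final state together licenses the interchange of the
  -- two sums.
  have hS : Summable fun p : E × E => P s x p.2 * P t p.2 p.1 * f p.1 := by
    refine Summable.of_norm ?_
    rw [summable_prod_of_nonneg (fun _ => norm_nonneg _)]
    have h2 : ∀ y, HasSum (fun z => ‖P s x z * P t z y * f y‖) (P (s + t) x y * |f y|) :=
      fun y => by
        refine (h1 y |f y|).congr_fun fun z => ?_
        simp [abs_of_nonneg (hP.nonneg _ _ _)]
    refine ⟨fun y => (h2 y).summable, ?_⟩
    simp only [(h2 _).tsum_eq]
    exact hP.summable_abs hst hf x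
  have h3 := hS.hasSum.prod_fiberwise fun y => h1 y (f y)
  have h4 : HasSum (fun p : E × E => P s x p.1 * P t p.1 p.2 * f p.2) _ :=
    (Equiv.prodComm E E).hasSum_iff.2 hS.hasSum
  have h5 := h4.prod_fiberwise fun z => (h4.summable.prod_factor z).hasSum
  simp only [act]
  simp only [mul_assoc, tsum_mul_left] at h5
  rw [h5.tsum_eq, h3.tsum_eq]
  simp only [mul_assoc]

/-- Expand the square under the joint law: each marginal contributes `scal π f f` and the cross term
is the correlation of `f` with `P_t f`. -/
theorem hasSum_dirichlet {f : E → ℝ} (hf : MemL2 π f) :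
    HasSum (fun p : E × E => π p.1 * P t p.1 p.2 * (f p.1 - f p.2) ^ 2)
      (2 * (scal π f f - scal π f (act P t f))) := by
  have h1 := hP.hasSum_joint_left ht (g := fun x => f x ^ 2) hf
  have h2 := hP.hasSum_joint_right ht (g := fun x => f x ^ 2) hf
  have h3 : Summable fun p : E × E => π p.1 * P t p.1 p.2 * (f p.1 * f p.2) := by
    refine Summable.of_norm_bounded (h1.summable.add h2.summable) fun p => ?_
    have hw : 0 ≤ π p.1 * P t p.1 p.2 := mul_nonneg (hP.pos _).le (hP.nonneg _ _ _)
    rw [Real.norm_eq_abs, abs_mul, abs_of_nonneg hw, ← mul_add]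
    refine mul_le_mul_of_nonneg_left ?_ hw
    rw [abs_le]
    constructor <;> nlinarith [sq_nonneg (f p.1 + f p.2), sq_nonneg (f p.1 - f p.2)]
  have h4 : ∑' p : E × E, π p.1 * P t p.1 p.2 * (f p.1 * f p.2) = scal π f (act P t f) := by
    rw [← (h3.hasSum.prod_fiberwise fun x => (h3.prod_factor x).hasSum).tsum_eq, scal]
    congr 1; funext x
    rw [act, ← tsum_mul_left, ← tsum_mul_right]
    congr 1; funext y
    ring
  have h5 := (h1.add h2).sub (h3.hasSum.mul_left 2)
  rw [h4] at h5
  have h6 : 2 * (scal π f f - scal π f (act P t f)) =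
      ∑' x, f x ^ 2 * π x + ∑' x, f x ^ 2 * π x - 2 * scal π f (act P t f) := by
    simp only [scal, ← sq]; ring
  rw [h6]
  exact h5.congr_fun fun p => by ring

end IsReversibleSemigroup

end MarkovChain

/-! ### Contraction semigroups on a real Hilbert space -/

section

open Filter Set MeasureTheory

/-- A strongly continuous contraction semigroup, extended to negative times in a continuous way. -/
structure ContractionSemigroup {H : Type*} [NormedAddCommGroup H] [InnerProductSpace ℝ H]
    (T : ℝ → H →L[ℝ] H) : Prop where
  zero : ∀ v, T 0 v = v
  add : ∀ s t, 0 ≤ s → 0 ≤ t → ∀ v, T (s + t) v = T s (T t v)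
  norm_le : ∀ t v, ‖T t v‖ ≤ ‖v‖
  cont : ∀ v, Continuous fun t => T t v

namespace ContractionSemigroup

variable {H : Type*} [NormedAddCommGroup H] [InnerProductSpace ℝ H] {T : ℝ → H →L[ℝ] H}

/-- `a` is the value at `u` of the generator of `T`. -/
def HasGenerator (T : ℝ → H →L[ℝ] H) (u a : H) : Prop :=
  Tendsto (fun h : ℝ => h⁻¹ • (T h u - u)) (𝓝[>] 0) (𝓝 a)

theorem HasGenerator.smul {u a : H} (h : HasGenerator T u a) (c : ℝ) :
    HasGenerator T (c • u) (c • a) := by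
  refine (h.const_smul c).congr fun t => ?_
  rw [map_smul, ← smul_sub, smul_comm]

variable (hT : ContractionSemigroup T)

include hT

theorem HasGenerator.map {u a : H} (h : HasGenerator T u a) {t : ℝ} (ht : 0 ≤ t) :
    HasGenerator T (T t u) (T t a) := by
  refine (((T t).continuous.tendsto a).comp h).congr' ?_
  filter_upwards [self_mem_nhdsWithin] with s hs
  simp only [Function.comp, map_smul, map_sub]
  rw [← hT.add t s ht (le_of_lt hs), ← hT.add s t (le_of_lt hs) ht, add_comm]

theorem HasGenerator.hasDerivWithinAt {u a : H} (h : HasGenerator T u a) {t : ℝ} (ht : 0 ≤ t) :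
    HasDerivWithinAt (fun s => T s u) (T t a) (Ici t) t := by
  rw [← hasDerivWithinAt_Ioi_iff_Ici, hasDerivWithinAt_iff_tendsto_slope' self_notMem_Ioi]
  have h1 := HasGenerator.map hT h ht
  have h2 : Tendsto (fun s : ℝ => s - t) (𝓝[>] t) (𝓝[>] 0) := by
    refine tendsto_nhdsWithin_iff.2 ⟨?_, ?_⟩
    · have : Tendsto (fun s : ℝ => s - t) (𝓝 t) (𝓝 (t - t)) := (continuous_sub_right t).tendsto t
      rw [sub_self] at this
      exact this.mono_left nhdsWithin_le_nhds
    · filter_upwards [self_mem_nhdsWithin] with s hs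
      exact sub_pos.2 (mem_Ioi.1 hs)
  refine (Tendsto.comp h1 h2).congr' ?_
  filter_upwards [self_mem_nhdsWithin] with s hs
  simp only [Function.comp, slope, vsub_eq_sub]
  rw [← hT.add (s - t) t (sub_pos.2 (mem_Ioi.1 hs)).le ht, sub_add_cancel]

/-- The orbit of `u` stays in the domain and orthogonal to `c`, so `hg` applies at every time and
`e^{2gs} ‖T s u‖²` has nonpositive right derivative. A one-sided derivative suffices for the
comparison lemma. -/
theorem norm_le_exp_of_generator {c : H} (hc : ∀ t, 0 ≤ t → ∀ v, inner ℝ c (T t v) = inner ℝ c v)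
    {g : ℝ} (hg : ∀ u a, HasGenerator T u a → inner ℝ c u = 0 → inner ℝ u a ≤ -g * ‖u‖ ^ 2)
    {u a : H} (h : HasGenerator T u a) (hu : inner ℝ c u = 0) {t : ℝ} (ht : 0 ≤ t) :
    ‖T t u‖ ≤ Real.exp (-g * t) * ‖u‖ := by
  have hd : ∀ s ∈ Ico 0 t, HasDerivWithinAt (fun s => Real.exp (2 * g * s) * ‖T s u‖ ^ 2)
      (Real.exp (2 * g * s) * (2 * g) * ‖T s u‖ ^ 2 +
        Real.exp (2 * g * s) * (2 * inner ℝ (T s u) (T s a))) (Ici s) s := by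
    intro s hs
    have h1 := (HasGenerator.hasDerivWithinAt hT h hs.1).norm_sq
    have h2 : HasDerivWithinAt (fun s : ℝ => Real.exp (2 * g * s))
        (Real.exp (2 * g * s) * (2 * g)) (Ici s) s := by
      simpa using (((hasDerivAt_id s).const_mul (2 * g)).exp).hasDerivWithinAt
    exact h2.mul h1
  have hmain := image_le_of_deriv_right_le_deriv_boundary (a := 0) (b := t)
    (f := fun s => Real.exp (2 * g * s) * ‖T s u‖ ^ 2) (B := fun _ => ‖u‖ ^ 2) (B' := fun _ => 0)
    (by have := hT.cont u; fun_prop) hd (by simp [hT.zero]) continuousOn_const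
    (fun s _ => hasDerivWithinAt_const _ _ _) (fun s hs => by
      have := hg _ _ (HasGenerator.map hT h hs.1) (by rw [hc s hs.1, hu])
      have he := Real.exp_pos (2 * g * s)
      have : Real.exp (2 * g * s) * inner ℝ (T s u) (T s a) ≤
        Real.exp (2 * g * s) * (-g * ‖T s u‖ ^ 2) := mul_le_mul_of_nonneg_left this he.le
      nlinarith) (right_mem_Icc.2 ht)
  have hsq : ‖T t u‖ ^ 2 ≤ (Real.exp (-g * t) * ‖u‖) ^ 2 := by
    have he : Real.exp (-g * t) ^ 2 * Real.exp (2 * g * t) = 1 := by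
      rw [sq, ← Real.exp_add, ← Real.exp_add, Real.exp_eq_one_iff]; ring
    have := mul_le_mul_of_nonneg_left hmain (sq_nonneg (Real.exp (-g * t)))
    rw [← mul_assoc, he, one_mul] at this
    rw [mul_pow]; exact this
  exact le_of_sq_le_sq hsq (by positivity)

variable [CompleteSpace H]

theorem hasDerivAt_integral (v : H) (b : ℝ) :
    HasDerivAt (fun b => ∫ s in (0 : ℝ)..b, T s v) (T b v) b :=
  intervalIntegral.integral_hasDerivAt_right ((hT.cont v).intervalIntegrable _ _)
    ((hT.cont v).stronglyMeasurableAtFilter _ _) (hT.cont v).continuousAt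

/-- Time integrals belong to the domain of the generator. -/
theorem hasGenerator_integral (v : H) {r : ℝ} (hr : 0 ≤ r) :
    HasGenerator T (∫ s in (0 : ℝ)..r, T s v) (T r v - v) := by
  have hc := hT.cont v
  -- `T h` shifts the window of integration to `[h, r + h]`, so `T h w` is this difference of two
  -- integrals from `0`, whose derivative at `h = 0` is read off from the endpoints.
  have h1 : HasDerivAt (fun h => (∫ s in (0 : ℝ)..(h + r), T s v) - ∫ s in (0 : ℝ)..h, T s v)
      (T r v - v) 0 := by
    have h2 := HasDerivAt.comp_add_const (x := 0) (a := r) (hf := hT.hasDerivAt_integral v (0 + r))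
    have h3 := h2.fun_sub (hT.hasDerivAt_integral v 0)
    simpa [hT.zero] using h3
  refine h1.tendsto_slope_zero_right.congr' ?_
  filter_upwards [self_mem_nhdsWithin] with h hh
  have hh' : 0 ≤ h := le_of_lt hh
  congr 1
  have h2 : T h (∫ s in (0 : ℝ)..r, T s v) = ∫ s in (0 : ℝ)..r, T (s + h) v := by
    rw [← ContinuousLinearMap.intervalIntegral_comp_comm _ (hc.intervalIntegrable _ _)]
    refine intervalIntegral.integral_congr fun s hs => ?_
    rw [uIcc_of_le hr] at hs
    rw [add_comm, hT.add h s hh' hs.1]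
  rw [h2, intervalIntegral.integral_comp_add_right (fun s => T s v)]
  simp only [zero_add, intervalIntegral.integral_same, sub_zero]
  have h3 := intervalIntegral.integral_add_adjacent_intervals
    (hc.intervalIntegrable (μ := volume) 0 h) (hc.intervalIntegrable (μ := volume) h (r + h))
  rw [add_comm h r, ← h3]
  abel

theorem tendsto_average (v : H) :
    Tendsto (fun r : ℝ => r⁻¹ • ∫ s in (0 : ℝ)..r, T s v) (𝓝[>] 0) (𝓝 v) := by
  have h := (hT.hasDerivAt_integral v 0).tendsto_slope_zero_right
  simpa [hT.zero] using h

theorem inner_integral {c : H} (hc : ∀ t, 0 ≤ t → ∀ v, inner ℝ c (T t v) = inner ℝ c v)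
    {v : H} (hv : inner ℝ c v = 0) {r : ℝ} (hr : 0 ≤ r) :
    inner ℝ c (∫ s in (0 : ℝ)..r, T s v) = 0 := by
  have h := ContinuousLinearMap.intervalIntegral_comp_comm (innerSL ℝ c)
    ((hT.cont v).intervalIntegrable (μ := volume) 0 r)
  rw [innerSL_apply_apply] at h
  rw [← h, intervalIntegral.integral_congr (g := fun _ => (0 : ℝ)), intervalIntegral.integral_zero]
  intro s hs
  rw [uIcc_of_le hr] at hs
  simp [hc s hs.1, hv]

/-- Density argument: the short-time averages of `v` lie in the domain, remain orthogonal to `c` and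
converge to `v`. -/
theorem norm_le_exp {c : H} (hc : ∀ t, 0 ≤ t → ∀ v, inner ℝ c (T t v) = inner ℝ c v)
    {g : ℝ} (hg : ∀ u a, HasGenerator T u a → inner ℝ c u = 0 → inner ℝ u a ≤ -g * ‖u‖ ^ 2)
    {v : H} (hv : inner ℝ c v = 0) {t : ℝ} (ht : 0 ≤ t) :
    ‖T t v‖ ≤ Real.exp (-g * t) * ‖v‖ := by
  have h1 := hT.tendsto_average v
  have h2 := (((T t).continuous.tendsto v).comp h1).norm
  refine le_of_tendsto_of_tendsto h2 (h1.norm.const_mul (Real.exp (-g * t))) ?_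
  filter_upwards [self_mem_nhdsWithin] with r hr
  have hr' : 0 ≤ r := le_of_lt hr
  refine hT.norm_le_exp_of_generator hc hg ((hT.hasGenerator_integral v hr').smul r⁻¹) ?_ ht
  rw [inner_smul_right, hT.inner_integral hc hv hr', mul_zero]

/-- A nonzero vector orthogonal to `c` yields one in the domain of the generator. -/
theorem exists_hasGenerator {c : H} (hc : ∀ t, 0 ≤ t → ∀ v, inner ℝ c (T t v) = inner ℝ c v)
    {v : H} (hv : inner ℝ c v = 0) (hne : v ≠ 0) :
    ∃ u a, HasGenerator T u a ∧ inner ℝ c u = 0 ∧ ‖u‖ = 1 := by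
  have h1 := (hT.tendsto_average v).eventually_ne hne
  obtain ⟨r, hr, hr0⟩ := (h1.and self_mem_nhdsWithin).exists
  have hr' : 0 ≤ r := le_of_lt hr0
  set w := ∫ s in (0 : ℝ)..r, T s v
  have hw : w ≠ 0 := fun h => hr (by rw [h, smul_zero])
  refine ⟨‖w‖⁻¹ • w, _, (hT.hasGenerator_integral v hr').smul _, ?_, ?_⟩
  · rw [inner_smul_right, hT.inner_integral hc hv hr', mul_zero]
  · rw [norm_smul, norm_inv, norm_norm, inv_mul_cancel₀ (norm_ne_zero_iff.2 hw)]

end ContractionSemigroup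

end

/-! ### The semigroup as operators on `ℓ²` and its strong continuity -/

namespace MarkovChain

open Filter Set

namespace IsReversibleSemigroup

variable {E : Type*} [DecidableEq E] {π : E → ℝ} {P : ℝ → E → E → ℝ}
  (hP : IsReversibleSemigroup π P)

include hP in
theorem act_ofLp_add (t : ℝ) (u v : lp (fun _ : E => ℝ) 2) :
    act P |t| (ofLp π (u + v)) =
      fun x => act P |t| (ofLp π u) x + act P |t| (ofLp π v) x := by
  rw [map_add]
  exact hP.act_add (abs_nonneg t) (memL2_ofLp hP.pos u) (memL2_ofLp hP.pos v)

/-- The operator on `ℓ²` that corresponds to `P_t` on `L²(E, π)`. -/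
def op (t : ℝ) : lp (fun _ : E => ℝ) 2 →L[ℝ] lp (fun _ : E => ℝ) 2 :=
  LinearMap.mkContinuous
    -- The absolute value makes the family contractive and continuous on the whole line, so
    -- integrals have genuine two-sided derivatives at `0`.
    { toFun := fun v => toLp hP.pos (act P |t| (ofLp π v))
        (hP.memL2_act (abs_nonneg t) (memL2_ofLp hP.pos v))
      map_add' := fun u v => by
        apply ofLp_injective hP.pos
        rw [map_add (ofLp π) (toLp hP.pos _ _), ofLp_toLp, ofLp_toLp, ofLp_toLp, hP.act_ofLp_add]
        rfl
      map_smul' := fun c v => by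
        apply ofLp_injective hP.pos
        rw [map_smul (ofLp π) _ (toLp hP.pos _ _), ofLp_toLp, ofLp_toLp, map_smul]
        funext x
        simp only [act, Pi.smul_apply, smul_eq_mul, RingHom.id_apply]
        rw [← tsum_mul_left]
        congr 1; funext y; ring }
    1 (fun v => by
      rw [one_mul, norm_eq_norm2 hP.pos, norm_eq_norm2 hP.pos]
      simp only [LinearMap.coe_mk, AddHom.coe_mk, ofLp_toLp]
      exact hP.norm2_act_le (abs_nonneg t) (memL2_ofLp hP.pos v))

theorem ofLp_op (t : ℝ) (v : lp (fun _ : E => ℝ) 2) :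
    ofLp π (hP.op t v) = act P |t| (ofLp π v) :=
  ofLp_toLp hP.pos _ (hP.memL2_act (abs_nonneg t) (memL2_ofLp hP.pos v))

theorem norm_op_le (t : ℝ) (v : lp (fun _ : E => ℝ) 2) : ‖hP.op t v‖ ≤ ‖v‖ := by
  rw [norm_eq_norm2 hP.pos, norm_eq_norm2 hP.pos, ofLp_op]
  exact hP.norm2_act_le (abs_nonneg t) (memL2_ofLp hP.pos v)

theorem op_zero (v : lp (fun _ : E => ℝ) 2) : hP.op 0 v = v := by
  apply ofLp_injective hP.pos
  rw [ofLp_op, abs_zero]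
  funext x
  rw [act, tsum_eq_single x]
  · simp [hP.zero]
  · intro y hy; simp [hP.zero, hy.symm]

theorem op_add {s t : ℝ} (hs : 0 ≤ s) (ht : 0 ≤ t) (v : lp (fun _ : E => ℝ) 2) :
    hP.op (s + t) v = hP.op s (hP.op t v) := by
  apply ofLp_injective hP.pos
  rw [ofLp_op, ofLp_op, ofLp_op, abs_of_nonneg hs, abs_of_nonneg ht,
    abs_of_nonneg (add_nonneg hs ht), hP.act_act ht hs (memL2_ofLp hP.pos v)]

theorem op_single_apply (t : ℝ) (y : E) (a : ℝ) :
    hP.op t (lp.single 2 y a) y = P |t| y y * a := by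
  have h : ofLp π (hP.op t (lp.single 2 y a)) y = P |t| y y * (a / √(π y)) := by
    rw [ofLp_op, act, tsum_eq_single y]
    · simp [ofLp_apply]
    · intro z hz
      simp [ofLp_apply, hz]
  rw [ofLp_apply, ← mul_div_assoc, div_left_inj' (Real.sqrt_pos.2 (hP.pos y)).ne'] at h
  exact h

/-- For a contraction, `‖T e - e‖² ≤ 2‖e‖² - 2⟨T e, e⟩`; on a coordinate vector the right side is
`2a²(1 - P t y y)`, which tends to zero by `diag`. -/
theorem tendsto_op_single (y : E) (a : ℝ) :
    Tendsto (fun t => hP.op t (lp.single 2 y a) - lp.single 2 y a) (𝓝[>] 0) (𝓝 0) := by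
  rw [tendsto_zero_iff_norm_tendsto_zero]
  have h1 : Tendsto (fun t => √(2 * (a ^ 2 * (1 - P t y y)))) (𝓝[>] 0) (𝓝 0) := by
    have := (((tendsto_const_nhds (x := (1 : ℝ))).sub (hP.diag y)).const_mul (a ^ 2)).const_mul 2
    simpa using this.sqrt
  refine tendsto_of_tendsto_of_tendsto_of_le_of_le' tendsto_const_nhds h1
    (Eventually.of_forall fun _ => norm_nonneg _) ?_
  filter_upwards [self_mem_nhdsWithin] with t ht
  refine Real.le_sqrt_of_sq_le ?_
  have h2 : inner ℝ (hP.op t (lp.single 2 y a)) (lp.single 2 y a) = P t y y * a * a := by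
    rw [lp.inner_single_right, op_single_apply, abs_of_pos (mem_Ioi.1 ht)]
    simp [mul_comm]
  have h3 : ‖(lp.single 2 y a : lp (fun _ : E => ℝ) 2)‖ ^ 2 = a ^ 2 := by
    rw [lp.norm_single (by norm_num)]; simp
  have h4 := hP.norm_op_le t (lp.single 2 y a)
  have h5 : ‖hP.op t (lp.single 2 y a)‖ ^ 2 ≤ a ^ 2 := by
    rw [← h3]; gcongr
  rw [norm_sub_sq_real, h2, h3]
  nlinarith

/-- Finite combinations of coordinate vectors are dense and the operators are contractions, so an
`ε/3` argument extends the continuity at zero. -/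
theorem tendsto_op (v : lp (fun _ : E => ℝ) 2) :
    Tendsto (fun t => hP.op t v) (𝓝[>] 0) (𝓝 v) := by
  rw [Metric.tendsto_nhds]
  intro ε hε
  have hv := lp.hasSum_single (p := 2) (by norm_num) v
  obtain ⟨S, hS⟩ := (Metric.tendsto_nhds.1 hv (ε / 3) (by positivity)).exists
  set u : lp (fun _ : E => ℝ) 2 := ∑ i ∈ S, lp.single 2 i (v i) with hu
  have h1 : Tendsto (fun t => hP.op t u - u) (𝓝[>] 0) (𝓝 0) := by
    have h2 := tendsto_finsetSum S fun i _ => hP.tendsto_op_single i (v i)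
    simpa [hu, map_sum, Finset.sum_sub_distrib] using h2
  filter_upwards [Metric.tendsto_nhds.1 h1 (ε / 3) (by positivity)] with t ht
  rw [dist_zero_right] at ht
  rw [dist_eq_norm] at hS ⊢
  have h3 : hP.op t v - v = (hP.op t u - u) + (u - v) - hP.op t (u - v) := by
    rw [map_sub]; abel
  have h4 := hP.norm_op_le t (u - v)
  have h5 := norm_sub_le (hP.op t u - u + (u - v)) (hP.op t (u - v))
  have h6 := norm_add_le (hP.op t u - u) (u - v)
  rw [h3]
  linarith

theorem op_abs (t : ℝ) (v : lp (fun _ : E => ℝ) 2) : hP.op |t| v = hP.op t v := by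
  apply ofLp_injective hP.pos
  rw [ofLp_op, ofLp_op, abs_abs]

theorem norm_op_sub_op_le {s t : ℝ} (hs : 0 ≤ s) (hst : s ≤ t) (v : lp (fun _ : E => ℝ) 2) :
    ‖hP.op t v - hP.op s v‖ ≤ ‖hP.op (t - s) v - v‖ := by
  have h : hP.op t v = hP.op s (hP.op (t - s) v) := by
    rw [← hP.op_add hs (sub_nonneg.2 hst), add_sub_cancel]
  rw [h, ← map_sub]
  exact hP.norm_op_le _ _

/-- By `norm_op_sub_op_le` the modulus of continuity at `0` from the right works at every time, on
both sides. -/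
theorem continuous_op (v : lp (fun _ : E => ℝ) 2) : Continuous fun t => hP.op t v := by
  rw [Metric.continuous_iff]
  intro t ε hε
  obtain ⟨δ, hδ, h⟩ := Metric.tendsto_nhdsWithin_nhds.1 (hP.tendsto_op v) ε hε
  have h0 : ∀ r : ℝ, 0 ≤ r → r < δ → ‖hP.op r v - v‖ < ε := fun r hr hrδ => by
    rcases hr.eq_or_lt with rfl | hr
    · rw [op_zero, sub_self, norm_zero]; exact hε
    · have := h (mem_Ioi.2 hr) (by rw [dist_zero_right, Real.norm_eq_abs, abs_of_pos hr]; exact hrδ)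
      rwa [dist_eq_norm] at this
  refine ⟨δ, hδ, fun s hs => ?_⟩
  rw [Real.dist_eq] at hs
  have hs' := lt_of_le_of_lt (abs_abs_sub_abs_le_abs_sub s t) hs
  rw [← hP.op_abs s, ← hP.op_abs t, dist_eq_norm]
  rcases le_total |t| |s| with hle | hle
  · refine lt_of_le_of_lt (hP.norm_op_sub_op_le (abs_nonneg t) hle v)
      (h0 _ (sub_nonneg.2 hle) ?_)
    rwa [abs_of_nonneg (sub_nonneg.2 hle)] at hs'
  · rw [norm_sub_rev]
    refine lt_of_le_of_lt (hP.norm_op_sub_op_le (abs_nonneg s) hle v)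
      (h0 _ (sub_nonneg.2 hle) ?_)
    rw [abs_sub_comm] at hs'
    rwa [abs_of_nonneg (sub_nonneg.2 hle)] at hs'

theorem contractionSemigroup : ContractionSemigroup hP.op where
  zero := hP.op_zero
  add _ _ hs ht := hP.op_add hs ht
  norm_le := hP.norm_op_le
  cont := hP.continuous_op

include hP in
theorem continuous_act {f : E → ℝ} (hf : MemL2 π f) (x : E) :
    Continuous fun t => act P |t| f x := by
  have h := (continuous_ofLp (π := π) x).comp (hP.continuous_op (toLp hP.pos f hf))
  refine h.congr fun t => ?_
  simp only [Function.comp, ofLp_op, ofLp_toLp]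

/-- The constant function `1` in `ℓ²`. -/
def one : lp (fun _ : E => ℝ) 2 := toLp hP.pos (fun _ => 1) (memL2_const hP.sum.summable 1)

theorem inner_one (v : lp (fun _ : E => ℝ) 2) : inner ℝ hP.one v = mean π (ofLp π v) := by
  rw [real_inner_comm, inner_eq_scal hP.pos, one, ofLp_toLp, mean]

theorem inner_one_op (t : ℝ) (v : lp (fun _ : E => ℝ) 2) :
    inner ℝ hP.one (hP.op t v) = inner ℝ hP.one v := by
  rw [inner_one, inner_one, ofLp_op, hP.mean_act (abs_nonneg t) (memL2_ofLp hP.pos v)]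

end IsReversibleSemigroup

/-! ### Reversible chains with integrable exit rate -/

/-- `q` is a conservative matrix of transition intensities with finitely many possible jumps out
of each state, reversible with respect to the positive probability distribution `π`, with
integrable exit rate; `Q` is its operator. -/
structure IsReversibleRates {E : Type*} (π : E → ℝ) (q : E → E → ℝ)
    (Q : (E → ℝ) → E → ℝ) : Prop where
  pos : ∀ x, 0 < π x
  sum : HasSum π 1
  off_nonneg : ∀ x y, x ≠ y → 0 ≤ q x y
  finite : ∀ x, (Function.support (q x)).Finite
  conservative : ∀ x, HasSum (q x) 0
  reversible : ∀ x y, π x * q x y = π y * q y x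
  exit : Summable fun x => π x * q x x
  gen : ∀ f x, HasSum (fun y => q x y * f y) (Q f x)

namespace IsReversibleRates

variable {E : Type*} {π : E → ℝ} {q : E → E → ℝ} {Q : (E → ℝ) → E → ℝ}
  (hR : IsReversibleRates π q Q)

include hR

section Rates

variable [DecidableEq E]

theorem hasSum_off (x : E) (f : E → ℝ) :
    HasSum (fun z => if z = x then 0 else q x z * f z) (Q f x - q x x * f x) := by
  have h1 := (hR.gen f x).sub (hasSum_ite_eq x (q x x * f x))
  refine h1.congr_fun fun z => ?_
  by_cases h : z = x
  · subst h; simp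
  · simp [h]

theorem diag_nonpos (x : E) : q x x ≤ 0 := by
  have h1 := hR.hasSum_off x fun _ => 1
  have h2 : Q (fun _ => 1) x = 0 := by
    have := hR.gen (fun _ => 1) x
    simp only [mul_one] at this
    exact this.unique (hR.conservative x)
  have h3 := h1.nonneg fun z => by
    split_ifs with h
    · exact le_rfl
    · rw [mul_one]; exact hR.off_nonneg x z (Ne.symm h)
  rw [h2] at h3
  linarith

omit hR in
theorem offRate_eq (x z : E) : offRate q x z = ENNReal.ofReal (if z = x then 0 else q x z) := by
  rw [offRate]; split_ifs <;> simp

theorem tsum_offRate (x : E) : ∑' z, offRate q x z = ENNReal.ofReal (-q x x) := by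
  have h1 := hR.hasSum_off x fun _ => 1
  have h2 : Q (fun _ => 1) x = 0 := by
    have := hR.gen (fun _ => 1) x
    simp only [mul_one] at this
    exact this.unique (hR.conservative x)
  simp only [mul_one, h2, zero_sub] at h1
  simp only [offRate_eq]
  rw [← h1.tsum_eq, ENNReal.ofReal_tsum_of_nonneg _ h1.summable]
  intro z
  split_ifs with h
  · exact le_rfl
  · exact hR.off_nonneg x z (Ne.symm h)

theorem offRate_symm (x y : E) :
    ENNReal.ofReal (π x) * offRate q x y = ENNReal.ofReal (π y) * offRate q y x := by
  rw [offRate, offRate]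
  by_cases h : y = x
  · simp [h]
  · rw [if_neg h, if_neg (Ne.symm h), ← ENNReal.ofReal_mul (hR.pos x).le,
      ← ENNReal.ofReal_mul (hR.pos y).le, hR.reversible]

variable [Countable E]

theorem minimal_mass {t : ℝ} (ht : 0 ≤ t) (x : E) : ∑' y, minimal q t x y = 1 := by
  refine MarkovChain.minimal_mass q hR.diag_nonpos hR.tsum_offRate
    (w := fun x => ENNReal.ofReal (π x)) (fun x => by simpa using hR.pos x) hR.offRate_symm ?_ ht x
  have h : ∀ x, ENNReal.ofReal (π x) * ENNReal.ofReal (-q x x) =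
      ENNReal.ofReal (-(π x * q x x)) := fun x => by
    rw [← ENNReal.ofReal_mul (hR.pos x).le, mul_neg]
  simp only [h]
  exact hR.exit.neg.tsum_ofReal_ne_top

theorem minimal_ne_top {t : ℝ} (ht : 0 ≤ t) (x y : E) : minimal q t x y ≠ ∞ :=
  ne_top_of_le_ne_top ENNReal.one_ne_top
    ((ENNReal.le_tsum y).trans (hR.minimal_mass ht x).le)

theorem minimal_eq_ofReal {t : ℝ} (ht : 0 ≤ t) (x y : E) :
    minimal q t x y = ENNReal.ofReal (transition q t x y) := by
  rw [transition_eq, ENNReal.ofReal_toReal (hR.minimal_ne_top ht x y)]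

theorem isReversibleSemigroup : IsReversibleSemigroup π (transition q) where
  pos := hR.pos
  sum := hR.sum
  nonneg t x y := by rw [transition_eq]; exact ENNReal.toReal_nonneg
  mass t ht x := by
    have h := ENNReal.hasSum_toReal (f := minimal q t x)
      (by rw [hR.minimal_mass ht x]; exact ENNReal.one_ne_top)
    rw [← ENNReal.tsum_toReal_eq (hR.minimal_ne_top ht x), hR.minimal_mass ht x] at h
    rw [ENNReal.toReal_one] at h
    exact h.congr_fun fun y => transition_eq q t x y
  symm t x y := by
    have h := congrArg ENNReal.toReal (minimal_symm q hR.offRate_symm t x y)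
    simpa [transition_eq, ENNReal.toReal_ofReal (hR.pos _).le] using h
  zero x y := by
    rw [transition_eq, minimal_zero]; split_ifs <;> simp
  add s t hs ht x y := by
    have h1 := minimal_add q hs ht x y
    have hne : ∀ z, minimal q s x z * minimal q t z y ≠ ∞ := fun z =>
      ENNReal.mul_ne_top (hR.minimal_ne_top hs x z) (hR.minimal_ne_top ht z y)
    have h := ENNReal.hasSum_toReal (f := fun z => minimal q s x z * minimal q t z y)
      (by rw [← h1]; exact hR.minimal_ne_top (add_nonneg hs ht) x y)
    rw [← ENNReal.tsum_toReal_eq hne, ← h1] at h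
    simpa [transition_eq] using h
  diag x := by
    have h1 : Tendsto (fun t : ℝ => Real.exp (q x x * t)) (𝓝[>] 0) (𝓝 1) := by
      have : Continuous fun t : ℝ => Real.exp (q x x * t) := by fun_prop
      have := this.tendsto 0
      simp only [mul_zero, Real.exp_zero] at this
      exact this.mono_left nhdsWithin_le_nhds
    -- The return probability lies between the probability of no jump and one.
    refine tendsto_of_tendsto_of_tendsto_of_le_of_le' h1 tendsto_const_nhds ?_ ?_
    · filter_upwards [self_mem_nhdsWithin] with t ht
      have ht' : 0 ≤ t := le_of_lt ht
      rw [transition_eq]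
      have := ENNReal.toReal_mono (hR.minimal_ne_top ht' x x) (holding_le_minimal q t x)
      rwa [holding, ENNReal.toReal_ofReal (Real.exp_pos _).le] at this
    · filter_upwards [self_mem_nhdsWithin] with t ht
      have ht' : 0 ≤ t := le_of_lt ht
      rw [transition_eq]
      refine ENNReal.toReal_le_of_le_ofReal zero_le_one ?_
      rw [ENNReal.ofReal_one]
      exact (ENNReal.le_tsum x).trans (hR.minimal_mass ht' x).le

end Rates

end IsReversibleRates

end MarkovChain

/-! ### Identification of the L² generator with the rates -/

namespace MarkovChain

open Filter Set MeasureTheory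

namespace IsReversibleRates

open ContractionSemigroup

variable {E : Type*} [DecidableEq E] [Countable E] {π : E → ℝ} {q : E → E → ℝ}
  {Q : (E → ℝ) → E → ℝ} (hR : IsReversibleRates π q Q)

include hR

theorem tsum_minimal_mul {t : ℝ} (ht : 0 ≤ t) {f : E → ℝ} (hf : MemL2 π f) (h0 : ∀ y, 0 ≤ f y)
    (x : E) : ∑' y, minimal q t x y * ENNReal.ofReal (f y) =
      ENNReal.ofReal (act (transition q) t f x) := by
  have hP := hR.isReversibleSemigroup
  rw [act, ENNReal.ofReal_tsum_of_nonneg (fun y => mul_nonneg (hP.nonneg t x y) (h0 y))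
    (hP.summable_mul ht hf x)]
  congr 1; funext y
  rw [hR.minimal_eq_ofReal ht, ENNReal.ofReal_mul (hP.nonneg t x y)]

/-- The integrated backward equation with time reversed inside the integral: `t` then enters only
through a factor and an endpoint, so the right side is visibly differentiable. Nonnegativity of `f`
allows the transfer from extended nonnegative sums. -/
theorem act_eq_of_nonneg {f : E → ℝ} (hf : MemL2 π f) (h0 : ∀ y, 0 ≤ f y) (x : E) {t : ℝ}
    (ht : 0 ≤ t) :
    act (transition q) t f x = Real.exp (q x x * t) *
      (f x + ∑ z ∈ (hR.finite x).toFinset.erase x, q x z *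
        ∫ s in (0 : ℝ)..t, Real.exp (-(q x x * s)) * act (transition q) |s| f z) := by
  have hP := hR.isReversibleSemigroup
  have hact : ∀ s z, 0 ≤ act (transition q) s f z := fun s z =>
    tsum_nonneg fun y => mul_nonneg (hP.nonneg s z y) (h0 y)
  have hcont : ∀ z, Continuous fun s => Real.exp (-(q x x * s)) * act (transition q) |s| f z :=
    fun z => by
      have := hP.continuous_act hf z
      fun_prop
  have hI : ∀ z, 0 ≤ ∫ s in (0 : ℝ)..t, Real.exp (-(q x x * s)) * act (transition q) |s| f z :=
    fun z => intervalIntegral.integral_nonneg ht fun s _ =>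
      mul_nonneg (Real.exp_pos _).le (hact _ _)
  have hconv : ∀ z, conv (holding q x)
      (fun s => ∑' y, minimal q s z y * ENNReal.ofReal (f y)) t =
      ENNReal.ofReal (Real.exp (q x x * t) *
        ∫ s in (0 : ℝ)..t, Real.exp (-(q x x * s)) * act (transition q) |s| f z) := by
    intro z
    rw [conv_congr (fun _ _ => rfl) (fun s hs => hR.tsum_minimal_mul hs hf h0 z), conv_comm,
      ← intervalIntegral.integral_const_mul, intervalIntegral.integral_of_le ht,
      ofReal_integral_eq_lintegral_ofReal]
    · refine setLIntegral_congr_fun measurableSet_Ioc fun s hs => ?_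
      simp only
      rw [holding, ← ENNReal.ofReal_mul (hact _ _), abs_of_pos hs.1, ← mul_assoc, ← Real.exp_add,
        mul_comm]
      congr 3; ring
    · exact (((hcont z).const_mul _).intervalIntegrable _ _).1
    · exact Eventually.of_forall fun s => mul_nonneg (Real.exp_pos _).le
        (mul_nonneg (Real.exp_pos _).le (hact _ _))
  have h := minimal_backward q t x fun y => ENNReal.ofReal (f y)
  rw [hR.tsum_minimal_mul ht hf h0] at h
  simp only [hconv] at h
  rw [tsum_eq_sum (s := (hR.finite x).toFinset.erase x)] at h
  · have h2 : ∀ z ∈ (hR.finite x).toFinset.erase x, offRate q x z * ENNReal.ofReal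
        (Real.exp (q x x * t) *
          ∫ s in (0 : ℝ)..t, Real.exp (-(q x x * s)) * act (transition q) |s| f z) =
        ENNReal.ofReal (q x z * (Real.exp (q x x * t) *
          ∫ s in (0 : ℝ)..t, Real.exp (-(q x x * s)) * act (transition q) |s| f z)) := by
      intro z hz
      have hzx := (Finset.mem_erase.1 hz).1
      rw [offRate, if_neg hzx, ENNReal.ofReal_mul (hR.off_nonneg x z hzx.symm)]
    have hnn : ∀ z ∈ (hR.finite x).toFinset.erase x, 0 ≤ q x z * (Real.exp (q x x * t) *
          ∫ s in (0 : ℝ)..t, Real.exp (-(q x x * s)) * act (transition q) |s| f z) := by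
      intro z hz
      exact mul_nonneg (hR.off_nonneg x z (Finset.mem_erase.1 hz).1.symm)
        (mul_nonneg (Real.exp_pos _).le (hI z))
    rw [Finset.sum_congr rfl h2, ← ENNReal.ofReal_sum_of_nonneg hnn, holding,
      ← ENNReal.ofReal_mul (Real.exp_pos _).le,
      ← ENNReal.ofReal_add (mul_nonneg (Real.exp_pos _).le (h0 x)) (Finset.sum_nonneg hnn),
      ENNReal.ofReal_eq_ofReal_iff (hact _ _)
        (add_nonneg (mul_nonneg (Real.exp_pos _).le (h0 x)) (Finset.sum_nonneg hnn))] at h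
    rw [h, mul_add, Finset.mul_sum]
    congr 1
    refine Finset.sum_congr rfl fun z _ => ?_
    ring
  · intro z hz
    rw [Finset.mem_erase, Finite.mem_toFinset, Function.mem_support] at hz
    rw [offRate]
    by_cases hzx : z = x
    · simp [hzx]
    · have : q x z = 0 := by
        by_contra h'
        exact hz ⟨hzx, h'⟩
      simp [this]

omit [Countable E] in
theorem gen_eq_sum (f : E → ℝ) (x : E) :
    Q f x = q x x * f x + ∑ z ∈ (hR.finite x).toFinset.erase x, q x z * f z := by
  have h1 := hR.gen f x
  have h2 : HasSum (fun y => q x y * f y)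
      (∑ z ∈ insert x ((hR.finite x).toFinset.erase x), q x z * f z) := by
    refine hasSum_sum_of_ne_finset_zero fun z hz => ?_
    rw [Finset.mem_insert, Finset.mem_erase, Finite.mem_toFinset, Function.mem_support] at hz
    have : q x z = 0 := by
      by_contra h'
      exact hz (by tauto)
    simp [this]
  rw [h1.unique h2, Finset.sum_insert (Finset.notMem_erase _ _)]

theorem tendsto_slope_of_nonneg {f : E → ℝ} (hf : MemL2 π f) (h0 : ∀ y, 0 ≤ f y) (x : E) :
    Tendsto (fun t : ℝ => t⁻¹ * (act (transition q) t f x - f x)) (𝓝[>] 0) (𝓝 (Q f x)) := by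
  have hP := hR.isReversibleSemigroup
  have hcont : ∀ z, Continuous fun s => Real.exp (-(q x x * s)) * act (transition q) |s| f z :=
    fun z => by
      have := hP.continuous_act hf z
      fun_prop
  have hzero : ∀ z, act (transition q) 0 f z = f z := fun z => by
    rw [act, tsum_eq_single z]
    · simp [hP.zero]
    · intro y hy; simp [hP.zero, hy.symm]
  have hI : ∀ z, HasDerivAt (fun t => ∫ s in (0 : ℝ)..t,
      Real.exp (-(q x x * s)) * act (transition q) |s| f z) (f z) 0 := fun z => by
    have := intervalIntegral.integral_hasDerivAt_right
      ((hcont z).intervalIntegrable 0 0) ((hcont z).stronglyMeasurableAtFilter volume (𝓝 0))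
      (hcont z).continuousAt
    simpa [hzero] using this
  have hS : HasDerivAt (fun t => f x + ∑ z ∈ (hR.finite x).toFinset.erase x, q x z *
        ∫ s in (0 : ℝ)..t, Real.exp (-(q x x * s)) * act (transition q) |s| f z)
      (∑ z ∈ (hR.finite x).toFinset.erase x, q x z * f z) 0 :=
    (HasDerivAt.fun_sum fun z _ => (hI z).const_mul (q x z)).const_add (f x)
  have hE : HasDerivAt (fun t : ℝ => Real.exp (q x x * t)) (q x x) 0 := by
    simpa using ((hasDerivAt_id (0 : ℝ)).const_mul (q x x)).exp
  have hD := (hE.fun_mul hS).tendsto_slope_zero_right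
  rw [hR.gen_eq_sum]
  simp only [zero_add, intervalIntegral.integral_same, mul_zero, Finset.sum_const_zero, add_zero,
    Real.exp_zero, one_mul, smul_eq_mul] at hD
  refine hD.congr' ?_
  filter_upwards [self_mem_nhdsWithin] with t ht
  rw [hR.act_eq_of_nonneg hf h0 x (le_of_lt ht)]

/-- On all of `L²(E, π)` the pointwise derivative at time zero is given by the rates. -/
theorem tendsto_slope {f : E → ℝ} (hf : MemL2 π f) (x : E) :
    Tendsto (fun t : ℝ => t⁻¹ * (act (transition q) t f x - f x)) (𝓝[>] 0) (𝓝 (Q f x)) := by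
  have hP := hR.isReversibleSemigroup
  have hp : MemL2 π fun y => max (f y) 0 := hf.of_abs_le hR.pos fun y => by
    rw [abs_of_nonneg (le_max_right _ _)]; exact max_le (le_abs_self _) (abs_nonneg _)
  have hn : MemL2 π fun y => max (-f y) 0 := hf.of_abs_le hR.pos fun y => by
    rw [abs_of_nonneg (le_max_right _ _)]; exact max_le (neg_le_abs _) (abs_nonneg _)
  have hdec : ∀ y, f y = max (f y) 0 - max (-f y) 0 := fun y => by
    rcases le_total (f y) 0 with h | h
    · rw [max_eq_right h, max_eq_left (by linarith)]; ring
    · rw [max_eq_left h, max_eq_right (by linarith)]; ring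
  have h1 := (hR.tendsto_slope_of_nonneg hp (fun _ => le_max_right _ _) x).sub
    (hR.tendsto_slope_of_nonneg hn (fun _ => le_max_right _ _) x)
  have h2 : Q (fun y => max (f y) 0) x - Q (fun y => max (-f y) 0) x = Q f x := by
    refine ((hR.gen _ x).sub (hR.gen _ x)).unique ((hR.gen f x).congr_fun fun y => ?_)
    rw [← mul_sub, ← hdec]
  rw [h2] at h1
  refine h1.congr' ?_
  filter_upwards [self_mem_nhdsWithin] with t ht
  have h3 : act (transition q) t f x =
      act (transition q) t (fun y => max (f y) 0) x -
        act (transition q) t (fun y => max (-f y) 0) x := by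
    simp only [act]
    rw [← (hP.summable_mul (le_of_lt ht) hp x).tsum_sub (hP.summable_mul (le_of_lt ht) hn x)]
    congr 1; funext y
    rw [← mul_sub, ← hdec]
  rw [h3]
  conv_rhs => rw [hdec x]
  ring

/-- Norm convergence forces pointwise convergence, and the pointwise limit of the difference
quotients is already known from `tendsto_slope`. -/
theorem ofLp_generator {u a : lp (fun _ : E => ℝ) 2}
    (h : HasGenerator hR.isReversibleSemigroup.op u a) : ofLp π a = Q (ofLp π u) := by
  funext x
  refine tendsto_nhds_unique (((continuous_ofLp x).tendsto a).comp h) ?_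
  refine (hR.tendsto_slope (memL2_ofLp hR.pos u) x).congr' ?_
  filter_upwards [self_mem_nhdsWithin] with t ht
  simp only [Function.comp, map_smul, map_sub, Pi.smul_apply, Pi.sub_apply, smul_eq_mul,
    IsReversibleSemigroup.ofLp_op, abs_of_pos (mem_Ioi.1 ht)]

/-- With the converse `hasGenerator_toLp`, this matches the domain over which `gap` is taken with
that of the abstract generator. -/
theorem inDomain_ofLp {u a : lp (fun _ : E => ℝ) 2}
    (h : HasGenerator hR.isReversibleSemigroup.op u a) :
    InDomain π (transition q) Q (ofLp π u) := by
  have hP := hR.isReversibleSemigroup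
  have ha := hR.ofLp_generator h
  refine ⟨memL2_ofLp hR.pos u, ha ▸ memL2_ofLp hR.pos a,
    fun t ht => hP.memL2_act ht.le (memL2_ofLp hR.pos u), ?_⟩
  have h1 := tendsto_iff_norm_sub_tendsto_zero.1 h
  refine h1.congr' ?_
  filter_upwards [self_mem_nhdsWithin] with t ht
  rw [norm_eq_norm2 hR.pos]
  congr 1
  funext x
  rw [map_sub, map_smul, map_sub, hP.ofLp_op, ha, abs_of_pos (mem_Ioi.1 ht)]
  simp only [Pi.smul_apply, Pi.sub_apply, smul_eq_mul]
  rw [inv_mul_eq_div]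

theorem hasGenerator_toLp {f : E → ℝ} (h : InDomain π (transition q) Q f) :
    HasGenerator hR.isReversibleSemigroup.op (toLp hR.pos f h.1) (toLp hR.pos (Q f) h.2.1) := by
  refine tendsto_iff_norm_sub_tendsto_zero.2 (h.2.2.2.congr' ?_)
  filter_upwards [self_mem_nhdsWithin] with t ht
  rw [norm_eq_norm2 hR.pos]
  congr 1
  funext x
  rw [map_sub, map_smul, map_sub, IsReversibleSemigroup.ofLp_op, ofLp_toLp, ofLp_toLp,
    abs_of_pos (mem_Ioi.1 ht)]
  simp only [Pi.smul_apply, Pi.sub_apply, smul_eq_mul]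
  rw [inv_mul_eq_div]

theorem tendsto_transition_div {x y : E} (hxy : x ≠ y) :
    Tendsto (fun t : ℝ => t⁻¹ * transition q t x y) (𝓝[>] 0) (𝓝 (q x y)) := by
  have hf : MemL2 π (Pi.single y (1 : ℝ)) :=
    memL2_of_finite ((finite_singleton y).subset Pi.support_single_subset)
  have h := hR.tendsto_slope hf x
  have h1 : Q (Pi.single y 1) x = q x y := by
    refine (hR.gen _ x).unique ?_
    convert hasSum_single y _ using 1
    · simp
    · intro z hz; simp [hz]
  rw [h1] at h
  refine h.congr fun t => ?_
  have h2 : act (transition q) t (Pi.single y 1) x = transition q t x y := by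
    rw [act, tsum_eq_single y]
    · simp
    · intro z hz; simp [hz]
  rw [h2, Pi.single_eq_of_ne hxy, sub_zero]

/-- Restrict `hasSum_dirichlet` to finitely many pairs, divide by `t` and let `t` tend to zero. Only
this Fatou-type inequality is needed. Diagonal pairs contribute nothing, so the off-diagonal limit
`tendsto_transition_div` suffices. -/
theorem sum_dirichlet_le {u a : lp (fun _ : E => ℝ) 2}
    (h : HasGenerator hR.isReversibleSemigroup.op u a) (S : Finset (E × E)) :
    ∑ p ∈ S, π p.1 * q p.1 p.2 * (ofLp π u p.1 - ofLp π u p.2) ^ 2 ≤ 2 * -inner ℝ u a := by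
  have hP := hR.isReversibleSemigroup
  set f := ofLp π u with hf
  have hfm : MemL2 π f := memL2_ofLp hR.pos u
  have h1 : Tendsto (fun t : ℝ => ∑ p ∈ S, t⁻¹ * (π p.1 * transition q t p.1 p.2 *
      (f p.1 - f p.2) ^ 2)) (𝓝[>] 0)
      (𝓝 (∑ p ∈ S, π p.1 * q p.1 p.2 * (f p.1 - f p.2) ^ 2)) := by
    refine tendsto_finsetSum _ fun p _ => ?_
    by_cases hp : p.1 = p.2
    · simp [hp]
    · refine (((hR.tendsto_transition_div hp).const_mul (π p.1)).mul_const _).congr fun t => ?_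
      ring
  have h2 : Tendsto (fun t : ℝ => 2 * -inner ℝ u (t⁻¹ • (hP.op t u - u))) (𝓝[>] 0)
      (𝓝 (2 * -inner ℝ u a)) :=
    ((tendsto_const_nhds.inner h).neg).const_mul 2
  refine le_of_tendsto_of_tendsto h1 h2 ?_
  filter_upwards [self_mem_nhdsWithin] with t ht
  have ht' : (0 : ℝ) < t := ht
  have h3 := hP.hasSum_dirichlet ht'.le hfm
  have h4 := sum_le_hasSum S (fun p _ => mul_nonneg (mul_nonneg (hP.pos p.1).le
    (hP.nonneg t p.1 p.2)) (sq_nonneg (f p.1 - f p.2))) h3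
  rw [inner_smul_right, inner_sub_right, inner_eq_scal hR.pos, inner_eq_scal hR.pos, hP.ofLp_op,
    abs_of_pos ht', ← Finset.mul_sum]
  have h5 := mul_le_mul_of_nonneg_left h4 (inv_pos.2 ht').le
  refine h5.trans (le_of_eq ?_)
  ring

/-! ### From a Poincaré inequality to the gap and to exponential convergence -/

section Gap

variable {K : ℝ} (x₀ : E) (hK : 0 < K)
  (hpoin : ∀ f : E → ℝ, ∑' x, ENNReal.ofReal (π x * (f x - f x₀) ^ 2) ≤
    ENNReal.ofReal K * ∑' p : E × E, ENNReal.ofReal (π p.1 * q p.1 p.2 * (f p.1 - f p.2) ^ 2))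

include hK hpoin in
-- For mean-zero `f` the second moment about `f x₀` is `‖u‖² + f(x₀)²`, hence dominates the
-- variance. The factor `2` in the constant arises because the form runs over ordered pairs.
theorem poincare {u a : lp (fun _ : E => ℝ) 2}
    (h : HasGenerator hR.isReversibleSemigroup.op u a)
    (hu : inner ℝ hR.isReversibleSemigroup.one u = 0) :
    (2 * K)⁻¹ * ‖u‖ ^ 2 ≤ -inner ℝ u a := by
  have hP := hR.isReversibleSemigroup
  set f := ofLp π u with hf
  have hfm : MemL2 π f := memL2_ofLp hR.pos u
  have hnn : ∀ p : E × E, 0 ≤ π p.1 * q p.1 p.2 * (f p.1 - f p.2) ^ 2 := fun p => by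
    by_cases hp : p.1 = p.2
    · simp [hp]
    · exact mul_nonneg (mul_nonneg (hR.pos _).le (hR.off_nonneg _ _ hp)) (sq_nonneg _)
  have h1 : ∑' p : E × E, ENNReal.ofReal (π p.1 * q p.1 p.2 * (f p.1 - f p.2) ^ 2) ≤
      ENNReal.ofReal (2 * -inner ℝ u a) := by
    rw [ENNReal.tsum_eq_iSup_sum]
    refine iSup_le fun S => ?_
    rw [← ENNReal.ofReal_sum_of_nonneg fun p _ => hnn p]
    exact ENNReal.ofReal_le_ofReal (hR.sum_dirichlet_le h S)
  have hd : 0 ≤ 2 * -inner ℝ u a := by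
    simpa using hR.sum_dirichlet_le h ∅
  have hmean : HasSum (fun x => f x * π x) 0 := by
    have h2 : mean π f = 0 := by rw [← hu, hP.inner_one]
    have h3 := (hfm.summable_mul hR.pos hR.sum.summable).hasSum
    simp only [mean, scal, mul_one] at h2
    rwa [h2] at h3
  have hsq : HasSum (fun x => f x ^ 2 * π x) (‖u‖ ^ 2) := by
    have h2 := Summable.hasSum hfm
    rw [← real_inner_self_eq_norm_sq, inner_eq_scal hR.pos, scal]
    simpa only [sq] using h2
  have hvar : HasSum (fun x => π x * (f x - f x₀) ^ 2) (‖u‖ ^ 2 + f x₀ ^ 2) := by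
    have h2 := (hsq.sub (hmean.mul_left (2 * f x₀))).add (hR.sum.mul_left (f x₀ ^ 2))
    rw [mul_zero, sub_zero, mul_one] at h2
    exact h2.congr_fun fun x => by ring
  have h4 := (hpoin f).trans (mul_le_mul_right h1 _)
  rw [← ENNReal.ofReal_mul hK.le, ← ENNReal.ofReal_tsum_of_nonneg
    (fun x => mul_nonneg (hR.pos x).le (sq_nonneg _)) hvar.summable, hvar.tsum_eq,
    ENNReal.ofReal_le_ofReal_iff (mul_nonneg hK.le hd)] at h4
  rw [inv_mul_le_iff₀ (by positivity)]
  nlinarith [sq_nonneg (f x₀)]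

include hK hpoin in
theorem gap_set_bound {c : ℝ} (hc : c ∈ {c | ∃ f, InDomain π (transition q) Q f ∧ norm2 π f = 1 ∧
    mean π f = 0 ∧ c = -scal π f (Q f)}) : (2 * K)⁻¹ ≤ c := by
  obtain ⟨f, hf, hf1, hf0, rfl⟩ := hc
  have h := hR.poincare x₀ hK hpoin (hR.hasGenerator_toLp hf)
    (by rw [hR.isReversibleSemigroup.inner_one, ofLp_toLp, hf0])
  rw [norm_eq_norm2 hR.pos, inner_eq_scal hR.pos, ofLp_toLp, ofLp_toLp, hf1] at h
  simpa using h

include hK hpoin in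
-- Homogeneity: normalise `u` and compare with the infimum. The Poincaré inequality enters through
-- boundedness below, without which a real `sInf` carries no information.
theorem inner_generator_le {u a : lp (fun _ : E => ℝ) 2}
    (h : HasGenerator hR.isReversibleSemigroup.op u a)
    (hu : inner ℝ hR.isReversibleSemigroup.one u = 0) :
    inner ℝ u a ≤ -gap π (transition q) Q * ‖u‖ ^ 2 := by
  have hP := hR.isReversibleSemigroup
  by_cases hu0 : u = 0
  · simp [hu0]
  have hn : 0 < ‖u‖ := norm_pos_iff.2 hu0
  have h1 := h.smul ‖u‖⁻¹
  have h2 := hR.inDomain_ofLp h1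
  have h3 : gap π (transition q) Q ≤ -scal π (ofLp π (‖u‖⁻¹ • u)) (Q (ofLp π (‖u‖⁻¹ • u))) := by
    refine csInf_le ⟨(2 * K)⁻¹, fun c hc => hR.gap_set_bound x₀ hK hpoin hc⟩
      ⟨_, h2, ?_, ?_, rfl⟩
    · rw [← norm_eq_norm2 hR.pos, norm_smul, norm_inv, norm_norm, inv_mul_cancel₀ hn.ne']
    · rw [← hP.inner_one, inner_smul_right, hu, mul_zero]
  rw [← hR.ofLp_generator h1, ← inner_eq_scal hR.pos, inner_smul_left, inner_smul_right] at h3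
  simp only [conj_trivial] at h3
  have h4 : gap π (transition q) Q * ‖u‖ ^ 2 ≤
      -(‖u‖⁻¹ * (‖u‖⁻¹ * inner ℝ u a)) * ‖u‖ ^ 2 := mul_le_mul_of_nonneg_right h3 (sq_nonneg _)
  have h5 : -(‖u‖⁻¹ * (‖u‖⁻¹ * inner ℝ u a)) * ‖u‖ ^ 2 = -inner ℝ u a := by
    field_simp
  linarith

include hK hpoin in
theorem gap_pos {x₁ : E} (hne : x₁ ≠ x₀) : 0 < gap π (transition q) Q := by
  have hP := hR.isReversibleSemigroup
  -- Since `sInf ∅ = 0`, the lower bound alone is not enough: the set must be nonempty. This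
  -- two-point function has mean zero, and time averaging moves it into the domain.
  have hfin : MemL2 π (fun x => if x = x₁ then (π x₁)⁻¹ else if x = x₀ then -(π x₀)⁻¹ else 0) := by
    refine memL2_of_finite ((Set.toFinite {x₁, x₀}).subset fun x hx => ?_)
    by_contra h
    simp only [mem_insert_iff, mem_singleton_iff, not_or] at h
    simp [h] at hx
  set v := toLp hR.pos _ hfin
  have hv : inner ℝ hP.one v = 0 := by
    rw [hP.inner_one, ofLp_toLp, mean, scal, tsum_eq_sum (s := {x₁, x₀}), Finset.sum_pair hne]
    · have := (hR.pos x₀).ne'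
      have := (hR.pos x₁).ne'
      simp [hne.symm, *]
    · intro x hx
      simp only [Finset.mem_insert, Finset.mem_singleton, not_or] at hx
      simp [hx]
  have hv0 : v ≠ 0 := by
    intro h
    have h1 : ofLp π v x₁ = 0 := by rw [h, map_zero]; rfl
    rw [ofLp_toLp, if_pos rfl] at h1
    exact (inv_pos.2 (hR.pos x₁)).ne' h1
  obtain ⟨u, a, h, hu, hu1⟩ := hP.contractionSemigroup.exists_hasGenerator
    (fun t _ w => hP.inner_one_op t w) hv hv0
  refine lt_of_lt_of_le (by positivity : 0 < (2 * K)⁻¹) (le_csInf ?_ fun c hc =>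
    hR.gap_set_bound x₀ hK hpoin hc)
  exact ⟨_, ofLp π u, hR.inDomain_ofLp h, by rw [← norm_eq_norm2 hR.pos, hu1],
    by rw [← hP.inner_one, hu], rfl⟩

include hK hpoin in
theorem norm2_act_sub_mean_le {f : E → ℝ} (hf : MemL2 π f) {t : ℝ} (ht : 0 ≤ t) :
    norm2 π (fun x => act (transition q) t f x - mean π f) ≤
      Real.exp (-gap π (transition q) Q * t) * norm2 π (fun x => f x - mean π f) := by
  have hP := hR.isReversibleSemigroup
  have hc := memL2_const hR.sum.summable (mean π f)
  have hfc := hf.sub hR.pos hc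
  have hv : inner ℝ hP.one (toLp hR.pos _ hfc) = 0 := by
    rw [hP.inner_one, ofLp_toLp]
    have h1 := (hf.summable_mul hR.pos hR.sum.summable).hasSum.sub
      (hR.sum.mul_left (mean π f))
    have h2 : mean π f = ∑' x, f x * π x := by simp only [mean, scal, mul_one]
    rw [← h2, mul_one, sub_self] at h1
    simp only [mean, scal, mul_one, sub_mul] at h1 ⊢
    exact h1.tsum_eq
  have h := hP.contractionSemigroup.norm_le_exp (fun t _ w => hP.inner_one_op t w)
    (fun u a => hR.inner_generator_le x₀ hK hpoin) hv ht
  rw [norm_eq_norm2 hR.pos, norm_eq_norm2 hR.pos, hP.ofLp_op, ofLp_toLp, abs_of_nonneg ht] at h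
  convert h using 2
  funext x
  have h3 := congrFun (hP.act_add ht hfc hc) x
  simp only [sub_add_cancel, hP.act_const ht] at h3
  rw [h3]; ring

include hK hpoin in
-- By reversibility the density of the law at time `t` with respect to `π` is `P_t g`, where `g` is
-- the density of the point mass at `x`. Total variation is then an L¹ norm, bounded by the L² norm.
theorem exists_tvNorm_le (x : E) : ∃ C : ℝ, 0 < C ∧ ∀ t : ℝ, 0 < t →
    tvNorm (transition q t x) π ≤
      ENNReal.ofReal (C * Real.exp (-gap π (transition q) Q * t)) := by
  have hP := hR.isReversibleSemigroup
  have hg : MemL2 π (fun y => if y = x then (π x)⁻¹ else 0) := by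
    refine memL2_of_finite ((finite_singleton x).subset fun y hy => ?_)
    by_contra h
    rw [mem_singleton_iff] at h
    simp [h] at hy
  set g : E → ℝ := fun y => if y = x then (π x)⁻¹ else 0 with hgdef
  have hmean : mean π g = 1 := by
    rw [mean, scal, tsum_eq_single x]
    · simp [hgdef, (hR.pos x).ne']
    · intro y hy; simp [hgdef, hy]
  -- The added `1` only secures strict positivity.
  refine ⟨norm2 π (fun y => g y - 1) + 1, by
    have : 0 ≤ norm2 π (fun y => g y - 1) := Real.sqrt_nonneg _
    linarith, fun t ht => ?_⟩
  have hact : ∀ y, act (transition q) t g y = transition q t x y * (π y)⁻¹ := fun y => by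
    rw [act, tsum_eq_single x]
    · have h1 := hP.symm t x y
      have := (hR.pos x).ne'
      have := (hR.pos y).ne'
      simp only [hgdef, if_true]
      field_simp
      linarith
    · intro z hz; simp [hgdef, hz]
  have hm := (hP.memL2_act ht.le hg).sub hR.pos (memL2_const hR.sum.summable 1)
  have hs : Summable fun y => |act (transition q) t g y - 1| * π y := by
    refine (hm.summable_mul hR.pos hR.sum.summable).norm.congr fun y => ?_
    rw [Real.norm_eq_abs, abs_mul, abs_of_pos (hR.pos y)]
  have htv : tvNorm (transition q t x) π =
      ENNReal.ofReal (∑' y, |act (transition q) t g y - 1| * π y) := by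
    rw [tvNorm, ENNReal.ofReal_tsum_of_nonneg
      (fun y => mul_nonneg (abs_nonneg _) (hR.pos y).le) hs]
    congr 1; funext y
    rw [hact, ← abs_of_pos (hR.pos y), ← abs_mul, abs_of_pos (hR.pos y), sub_mul, one_mul,
      inv_mul_cancel_right₀ (hR.pos y).ne']
  rw [htv]
  refine ENNReal.ofReal_le_ofReal ?_
  have h1 : ∑' y, |act (transition q) t g y - 1| * π y ≤
      norm2 π (fun y => act (transition q) t g y - 1) := by
    -- Cauchy–Schwarz against the probability `π`, in the form of nonnegativity of the variance of
    -- `|P_t g - 1|`.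
    refine Real.le_sqrt_of_sq_le ?_
    have h2 := Summable.hasSum hm
    have h3 := (h2.sub (hs.hasSum.mul_left (2 * ∑' y, |act (transition q) t g y - 1| * π y))).add
      (hR.sum.mul_left ((∑' y, |act (transition q) t g y - 1| * π y) ^ 2))
    have h4 := h3.nonneg fun y => by
      have := mul_nonneg (sq_nonneg (|act (transition q) t g y - 1| -
        ∑' y, |act (transition q) t g y - 1| * π y)) (hR.pos y).le
      rw [sub_sq, sq_abs] at this
      linarith
    simp only [scal, ← sq]
    linarith
  have h5 := hR.norm2_act_sub_mean_le x₀ hK hpoin hg ht.le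
  rw [hmean] at h5
  have h6 := Real.exp_pos (-gap π (transition q) Q * t)
  linarith

end Gap

end IsReversibleRates

end MarkovChain

namespace MarkovChain

open Filter Set

/-! ### Chains described by finitely many kinds of moves -/

/-- The operator `Q` describes a chain that makes the move `a`, which leads from `x` to
`tgt a x`, with intensity `rate a x`; the move `rev a` undoes the move `a`, and the distribution
`π` is in detailed balance. -/
structure IsReversibleMoves {E A : Type*} [Fintype A] (π : E → ℝ) (Q : (E → ℝ) → E → ℝ)
    (tgt : A → E → E) (rate : A → E → ℝ) (rev : A → A) : Prop where
  pos : ∀ x, 0 < π x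
  sum : HasSum π 1
  rate_nonneg : ∀ a x, 0 ≤ rate a x
  summable : ∀ a, Summable fun x => π x * rate a x
  gen : ∀ f x, Q f x = ∑ a, (f (tgt a x) - f x) * rate a x
  rev_rev : ∀ a, rev (rev a) = a
  tgt_rev : ∀ a x, rate a x ≠ 0 → tgt (rev a) (tgt a x) = x
  balance : ∀ a x, rate a x ≠ 0 → π x * rate a x = π (tgt a x) * rate (rev a) (tgt a x)

namespace IsReversibleMoves

variable {E A : Type*} [Fintype A] [DecidableEq E] {π : E → ℝ} {Q : (E → ℝ) → E → ℝ}
  {tgt : A → E → E} {rate : A → E → ℝ} {rev : A → A} (hM : IsReversibleMoves π Q tgt rate rev)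

include hM

theorem intensity_of_ne {x y : E} (hxy : x ≠ y) :
    Q (Pi.single y 1) x = ∑ a, if tgt a x = y then rate a x else 0 := by
  rw [hM.gen]
  refine Finset.sum_congr rfl fun a _ => ?_
  rw [Pi.single_eq_of_ne hxy, sub_zero, Pi.single_apply]
  split_ifs <;> simp

/-- An inequality suffices: applied also to `rev a` with the states exchanged, it becomes an
equality. This form avoids a case analysis on vanishing rates on both sides. -/
theorem balance_le (a : A) (x y : E) :
    (if tgt a x = y then π x * rate a x else 0) ≤
      if tgt (rev a) y = x then π y * rate (rev a) y else 0 := by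
  have hnn : 0 ≤ if tgt (rev a) y = x then π y * rate (rev a) y else 0 := by
    split_ifs
    · exact mul_nonneg (hM.pos y).le (hM.rate_nonneg _ _)
    · exact le_rfl
  by_cases h : tgt a x = y
  · by_cases h0 : rate a x = 0
    · rw [if_pos h, h0, mul_zero]; exact hnn
    · subst h
      rw [if_pos rfl, if_pos (hM.tgt_rev a x h0), hM.balance a x h0]
  · rw [if_neg h]; exact hnn

theorem isReversibleRates : IsReversibleRates π (fun x y => Q (Pi.single y 1) x) Q where
  pos := hM.pos
  sum := hM.sum
  off_nonneg x y hxy := by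
    rw [hM.intensity_of_ne hxy]
    refine Finset.sum_nonneg fun a _ => ?_
    split_ifs
    · exact hM.rate_nonneg a x
    · exact le_rfl
  finite x := by
    refine (((Set.finite_range fun a => tgt a x).insert x)).subset fun y hy => ?_
    by_contra h
    rw [Set.mem_insert_iff, not_or] at h
    refine hy ?_
    change Q (Pi.single y 1) x = 0
    rw [hM.intensity_of_ne (Ne.symm h.1)]
    refine Finset.sum_eq_zero fun a _ => if_neg fun h' => h.2 ⟨a, h'⟩
  gen f x := by
    simp only [hM.gen, Finset.sum_mul]
    refine hasSum_sum fun a _ => ?_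
    have h1 := (hasSum_ite_eq (tgt a x) (f (tgt a x))).sub (hasSum_ite_eq x (f x))
    refine (h1.mul_right (rate a x)).congr_fun fun y => ?_
    rw [Pi.single_apply, Pi.single_apply]
    by_cases hy1 : y = tgt a x <;> by_cases hy2 : y = x <;>
      simp [hy1, hy2, eq_comm, mul_comm] <;> grind
  conservative x := by
    simp only [hM.gen]
    have h2 : HasSum (fun y => ∑ a, ((Pi.single y 1 : E → ℝ) (tgt a x) -
        (Pi.single y 1 : E → ℝ) x) * rate a x) (∑ a, (1 - 1) * rate a x) := by
      refine hasSum_sum fun a _ => ?_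
      refine HasSum.mul_right _ (HasSum.sub ?_ ?_)
      · refine (hasSum_ite_eq (tgt a x) (1 : ℝ)).congr_fun fun y => ?_
        simp [Pi.single_apply, eq_comm]
      · refine (hasSum_ite_eq x (1 : ℝ)).congr_fun fun y => ?_
        simp [Pi.single_apply, eq_comm]
    simpa using h2
  reversible x y := by
    by_cases hxy : x = y
    · rw [hxy]
    rw [hM.intensity_of_ne hxy, hM.intensity_of_ne (Ne.symm hxy), Finset.mul_sum, Finset.mul_sum]
    simp only [mul_ite, mul_zero]
    -- Reindexing by the involution pairs each move with its reverse, so detailed balance holds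
    -- summand by summand even when several moves share a target.
    rw [← Equiv.sum_comp (Function.Involutive.toPerm rev hM.rev_rev)
      (fun a => if tgt a y = x then π y * rate a y else 0)]
    refine Finset.sum_congr rfl fun a _ => le_antisymm (hM.balance_le a x y) ?_
    have := hM.balance_le (rev a) y x
    rwa [hM.rev_rev] at this
  exit := by
    refine Summable.of_norm_bounded (g := fun x => ∑ a, π x * rate a x)
      (summable_sum fun a _ => hM.summable a) fun x => ?_
    rw [hM.gen, Real.norm_eq_abs, abs_mul, abs_of_pos (hM.pos x), ← Finset.mul_sum]
    refine mul_le_mul_of_nonneg_left ?_ (hM.pos x).le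
    refine (Finset.abs_sum_le_sum_abs _ _).trans (Finset.sum_le_sum fun a _ => ?_)
    rw [abs_mul, abs_of_nonneg (hM.rate_nonneg a x)]
    refine mul_le_of_le_one_left (hM.rate_nonneg a x) ?_
    rw [Pi.single_apply, Pi.single_eq_same]
    split_ifs <;> simp

/-- The Dirichlet form (without the factor `1/2`), as an extended nonnegative real. -/
def energy {E : Type*} [DecidableEq E] (π : E → ℝ) (Q : (E → ℝ) → E → ℝ) (f : E → ℝ) : ℝ≥0∞ :=
  ∑' p : E × E, ENNReal.ofReal (π p.1 * Q (Pi.single p.2 1) p.1 * (f p.1 - f p.2) ^ 2)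

/-- The pairs `(x, tgt a x)` are distinct for distinct `x`, and `rate a x` is one nonnegative
summand of the intensity between them. A move that fixes `x` contributes zero. -/
theorem tsum_move_le_energy (a : A) (f : E → ℝ) :
    ∑' x, ENNReal.ofReal (π x * rate a x * (f (tgt a x) - f x) ^ 2) ≤ energy π Q f := by
  refine le_trans (ENNReal.tsum_le_tsum fun x => ?_)
    (ENNReal.tsum_comp_le_tsum_of_injective (f := fun x => (x, tgt a x))
      (fun x y h => (Prod.ext_iff.1 h).1) fun p : E × E =>
      ENNReal.ofReal (π p.1 * Q (Pi.single p.2 1) p.1 * (f p.1 - f p.2) ^ 2))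
  refine ENNReal.ofReal_le_ofReal ?_
  by_cases h : x = tgt a x
  · simp [← h]
  · simp only
    rw [hM.intensity_of_ne h, show (f (tgt a x) - f x) ^ 2 = (f x - f (tgt a x)) ^ 2 by ring]
    refine mul_le_mul_of_nonneg_right (mul_le_mul_of_nonneg_left ?_ (hM.pos x).le) (sq_nonneg _)
    have h2 := Finset.single_le_sum (f := fun b => if tgt b x = tgt a x then rate b x else 0)
      (fun b _ => by
        split_ifs
        · exact hM.rate_nonneg b x
        · exact le_rfl) (Finset.mem_univ a)
    simpa using h2

end IsReversibleMoves

end MarkovChain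

/-! ### The Poincaré inequality for strongly light-tailed distributions -/

/-- Summation by parts writes the second moment of `h = u - u 0` through the tails `T` and the
increments of `h²`. The hazard bound gives both `c T(k+1) ≤ p(k+1)` and `c T(k+1) ≤ p(k)`: with the
first, half of the second moment is absorbed on the left; with the second, the rest becomes the
increment sum. -/
theorem StronglyLightTailed.exists_hardy {p : ℕ → ℝ} (hp : StronglyLightTailed p) :
    ∃ C : ℝ, 0 < C ∧ ∀ u : ℕ → ℝ,
      ∑' k, ENNReal.ofReal (p k) * ENNReal.ofReal ((u k - u 0) ^ 2) ≤
        ENNReal.ofReal C * ∑' k, ENNReal.ofReal (p k) * ENNReal.ofReal ((u (k + 1) - u k) ^ 2) := by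
  obtain ⟨hpos, hsum, hinf⟩ := hp
  set c := ⨅ k, hazard p k with hc
  set T : ℕ → ℝ := fun k => ∑' j, p (k + j) with hT
  have hs : ∀ k, Summable fun j => p (k + j) := fun k =>
    hsum.summable.comp_injective (add_right_injective k)
  have hTpos : ∀ k, 0 < T k := fun k =>
    (hs k).tsum_pos (fun j => (hpos _).le) 0 (hpos _)
  have hTsucc : ∀ k, T k = p k + T (k + 1) := fun k => by
    simp only [hT]
    rw [(hs k).tsum_eq_zero_add]
    simp only [add_zero, add_assoc, add_comm 1]
  have hcT : ∀ k, c * T k ≤ p k := fun k => by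
    rw [← le_div_iff₀ (hTpos k)]
    exact ciInf_le ⟨0, by rintro _ ⟨k, rfl⟩; exact (div_pos (hpos k) (hTpos k)).le⟩ k
  refine ⟨4 / c ^ 2, by positivity, fun u => ?_⟩
  set h : ℕ → ℝ := fun k => u k - u 0 with hh
  -- The boundary term at `0` vanishes because `h 0 = 0`; the one at `N` is nonnegative and is
  -- dropped later.
  have habel : ∀ N, ∑ k ∈ Finset.range N, T (k + 1) * (h (k + 1) ^ 2 - h k ^ 2) =
      ∑ k ∈ Finset.range (N + 1), p k * h k ^ 2 + T (N + 1) * h N ^ 2 := by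
    intro N
    induction N with
    | zero => simp [hh]
    | succ N ih =>
      rw [Finset.sum_range_succ, ih, Finset.sum_range_succ _ (N + 1), hTsucc (N + 1)]; ring
  have hterm : ∀ k, T (k + 1) * (h (k + 1) ^ 2 - h k ^ 2) ≤
      p (k + 1) * h (k + 1) ^ 2 / 2 + 2 / c ^ 2 * (p k * (h (k + 1) - h k) ^ 2) := by
    intro k
    have h1 : h (k + 1) ^ 2 - h k ^ 2 ≤ c / 2 * h (k + 1) ^ 2 + 2 / c * (h (k + 1) - h k) ^ 2 := by
      have h2 : 0 ≤ (c / 2 * h (k + 1) - (h (k + 1) - h k)) ^ 2 * (2 / c) := by positivity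
      have h3 : (c / 2 * h (k + 1) - (h (k + 1) - h k)) ^ 2 * (2 / c) =
          c / 2 * h (k + 1) ^ 2 - 2 * h (k + 1) * (h (k + 1) - h k) +
            2 / c * (h (k + 1) - h k) ^ 2 := by
        field_simp
        ring
      nlinarith [sq_nonneg (h (k + 1) - h k)]
    have h4 : T (k + 1) * (c / 2 * h (k + 1) ^ 2) ≤ p (k + 1) * h (k + 1) ^ 2 / 2 := by
      nlinarith [mul_le_mul_of_nonneg_right (hcT (k + 1)) (sq_nonneg (h (k + 1)))]
    have h5 : T (k + 1) ≤ p k / c := by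
      rw [le_div_iff₀ hinf]
      have := hcT k
      rw [hTsucc k] at this
      nlinarith [mul_pos hinf (hpos k)]
    have h6 : T (k + 1) * (2 / c * (h (k + 1) - h k) ^ 2) ≤
        2 / c ^ 2 * (p k * (h (k + 1) - h k) ^ 2) := by
      have := mul_le_mul_of_nonneg_right h5
        (by positivity : 0 ≤ 2 / c * (h (k + 1) - h k) ^ 2)
      refine this.trans (le_of_eq ?_)
      field_simp
    have h7 := mul_le_mul_of_nonneg_left h1 (hTpos (k + 1)).le
    linarith
  -- Absorption is carried out on partial sums, where everything is finite; it doubles the constant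
  -- `2 / c ^ 2`.
  have hfin : ∀ N, ∑ k ∈ Finset.range (N + 1), p k * h k ^ 2 ≤
      4 / c ^ 2 * ∑ k ∈ Finset.range N, p k * (h (k + 1) - h k) ^ 2 := by
    intro N
    have h1 := Finset.sum_le_sum fun k (_ : k ∈ Finset.range N) => hterm k
    rw [habel, Finset.sum_add_distrib, ← Finset.sum_div, ← Finset.mul_sum] at h1
    have h2 : ∑ k ∈ Finset.range (N + 1), p k * h k ^ 2 =
        ∑ k ∈ Finset.range N, p (k + 1) * h (k + 1) ^ 2 := by
      rw [Finset.sum_range_succ']; simp [hh]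
    have h3 := mul_nonneg (hTpos (N + 1)).le (sq_nonneg (h N))
    rw [← h2] at h1
    have h4 : 4 / c ^ 2 = 2 * (2 / c ^ 2) := by ring
    rw [h4, mul_assoc]
    linarith
  rw [ENNReal.tsum_eq_iSup_nat]
  refine iSup_le fun N => ?_
  refine le_trans (Finset.sum_le_sum_of_subset (Finset.range_mono (Nat.le_succ N))) ?_
  have h1 : ∀ k, ENNReal.ofReal (p k) * ENNReal.ofReal ((u k - u 0) ^ 2) =
      ENNReal.ofReal (p k * h k ^ 2) := fun k => by
    rw [ENNReal.ofReal_mul (hpos k).le]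
  have h2 : ∀ k, ENNReal.ofReal (p k) * ENNReal.ofReal ((u (k + 1) - u k) ^ 2) =
      ENNReal.ofReal (p k * (h (k + 1) - h k) ^ 2) := fun k => by
    rw [ENNReal.ofReal_mul (hpos k).le]; simp [hh]
  simp only [h1, h2]
  rw [← ENNReal.ofReal_sum_of_nonneg fun k _ => mul_nonneg (hpos k).le (sq_nonneg _)]
  refine (ENNReal.ofReal_le_ofReal (hfin N)).trans ?_
  rw [ENNReal.ofReal_mul (by positivity),
    ENNReal.ofReal_sum_of_nonneg fun k _ => mul_nonneg (hpos k).le (sq_nonneg _)]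
  gcongr
  exact ENNReal.sum_le_tsum _

theorem HasSum.mul_of_nonneg {ι κ : Type*} {f : ι → ℝ} {g : κ → ℝ} {a b : ℝ} (hf : HasSum f a)
    (hg : HasSum g b) (hf0 : ∀ i, 0 ≤ f i) (hg0 : ∀ k, 0 ≤ g k) :
    HasSum (fun z : ι × κ => f z.1 * g z.2) (a * b) :=
  hf.mul hg (hf.summable.mul_of_nonneg hg.summable hf0 hg0)

theorem hasSum_prod_pi {m : ℕ} {p : Fin m → ℕ → ℝ} (hp : ∀ i k, 0 ≤ p i k)
    (hs : ∀ i, HasSum (p i) 1) : HasSum (fun n : Fin m → ℕ => ∏ i, p i (n i)) 1 := by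
  induction m with
  | zero =>
    simp only [Finset.univ_eq_empty, Finset.prod_empty]
    exact hasSum_unique _
  | succ m ih =>
    have h1 := ih (p := fun i => p i.succ) (fun i => hp _) (fun i => hs _)
    have h0 : ∀ n : Fin m → ℕ, 0 ≤ ∏ i, p (Fin.succ i) (n i) := fun n =>
      Finset.prod_nonneg fun i _ => hp i.succ (n i)
    have h3 := (hs 0).mul_of_nonneg h1 (hp 0) h0
    rw [mul_one] at h3
    rw [← (Fin.consEquiv fun _ => ℕ).hasSum_iff]
    refine h3.congr_fun fun z => ?_
    simp [Fin.prod_univ_succ, Fin.consEquiv]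

namespace JacksonNetwork

open MarkovChain

variable {m : ℕ} (N : JacksonNetwork m)

/-! ### The moves of the network -/

/-- The kinds of moves: arrivals and departures, migrations, breakdowns and repairs. -/
abbrev Move (m : ℕ) : Type :=
  (Fin m ⊕ Fin m) ⊕ (Fin m × Fin m) ⊕ (Finset (Fin m) ⊕ Finset (Fin m))

/-- The state reached by a move. -/
def tgt : Move m → State m → State m
  | .inl (.inl j), x => (x.1, inc j x.2)
  | .inl (.inr j), x => (x.1, dec j x.2)
  | .inr (.inl a), x => (x.1, inc a.2 (dec a.1 x.2))
  | .inr (.inr (.inl I)), x => (x.1 ∪ I, x.2)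
  | .inr (.inr (.inr H)), x => (x.1 \ H, x.2)

/-- The intensity of a move. -/
def rate : Move m → State m → ℝ
  | .inl (.inl j), x => N.lam * N.blocked x.1 none (some j)
  | .inl (.inr j), x => N.mu j (x.2 j) * N.blocked x.1 (some j) none
  | .inr (.inl a), x => N.mu a.1 (x.2 a.1) * N.blocked x.1 (some a.1) (some a.2)
  | .inr (.inr (.inl I)), x => if I ⊆ x.1ᶜ then N.psi (x.1 ∪ I) / N.psi x.1 else 0
  | .inr (.inr (.inr H)), x => if H ⊆ x.1 then N.phi x.1 / N.phi (x.1 \ H) else 0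

/-- The move in the opposite direction. -/
def rev : Move m → Move m
  | .inl (.inl j) => .inl (.inr j)
  | .inl (.inr j) => .inl (.inl j)
  | .inr (.inl a) => .inr (.inl (a.2, a.1))
  | .inr (.inr (.inl I)) => .inr (.inr (.inr I))
  | .inr (.inr (.inr H)) => .inr (.inr (.inl H))

theorem gen_eq_sum_moves (f : State m → ℝ) (x : State m) :
    N.gen f x = ∑ a : Move m, (f (tgt a x) - f x) * N.rate a x := by
  have hpow : ∀ (S : Finset (Fin m)) (F : Finset (Fin m) → ℝ),
      ∑ I ∈ S.powerset, F I = ∑ I, if I ⊆ S then F I else 0 := fun S F => by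
    rw [← Finset.sum_filter]
    congr 1
    ext I; simp
  rw [gen]
  simp only [Fintype.sum_sum_type, Fintype.sum_prod_type, tgt, rate, hpow, mul_ite, mul_zero]
  ring

@[simp]
theorem inc_apply_self (j : Fin m) (n : Fin m → ℕ) : inc j n j = n j + 1 := by simp [inc]

@[simp]
theorem dec_inc (j : Fin m) (n : Fin m → ℕ) : dec j (inc j n) = n := by
  simp [inc, dec]

theorem inc_dec {j : Fin m} {n : Fin m → ℕ} (h : n j ≠ 0) : inc j (dec j n) = n := by
  have : n j - 1 + 1 = n j := by omega
  simp [inc, dec, this]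

theorem inc_injective (j : Fin m) : Function.Injective (inc j) :=
  Function.LeftInverse.injective (dec_inc j)

theorem mu_pos (i : Fin m) {n : ℕ} (hn : 1 ≤ n) : 0 < N.mu i n := by
  obtain ⟨c, hc, h⟩ := N.mu_lower i
  exact hc.trans_le (h n hn)

theorem mu_nonneg (i : Fin m) (n : ℕ) : 0 ≤ N.mu i n := by
  rcases Nat.eq_zero_or_pos n with rfl | h
  · rw [N.mu_zero]
  · exact (N.mu_pos i h).le

theorem blocked_nonneg (D : Finset (Fin m)) (i j : Option (Fin m)) : 0 ≤ N.blocked D i j := by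
  rw [blocked]
  split_ifs
  · exact le_rfl
  · exact add_nonneg (N.r_nonneg _ _) (Finset.sum_nonneg fun k _ => N.r_nonneg _ _)
  · exact N.r_nonneg _ _

theorem rate_nonneg (a : Move m) (x : State m) : 0 ≤ N.rate a x := by
  match a with
  | .inl (.inl j) => exact mul_nonneg N.lam_pos.le (N.blocked_nonneg _ _ _)
  | .inl (.inr j) => exact mul_nonneg (N.mu_nonneg _ _) (N.blocked_nonneg _ _ _)
  | .inr (.inl a) => exact mul_nonneg (N.mu_nonneg _ _) (N.blocked_nonneg _ _ _)
  | .inr (.inr (.inl I)) =>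
    simp only [rate]
    split_ifs
    · exact (div_pos (N.psi_pos _) (N.psi_pos _)).le
    · exact le_rfl
  | .inr (.inr (.inr H)) =>
    simp only [rate]
    split_ifs
    · exact (div_pos (N.phi_pos _) (N.phi_pos _)).le
    · exact le_rfl

/-! ### The product form distribution -/

section Stat

variable {L : Fin m → ℝ}

theorem weight_succ (i : Fin m) (n : ℕ) :
    N.weight L i (n + 1) * N.mu i (n + 1) = N.weight L i n * L i := by
  have h := (N.mu_pos i (Nat.succ_pos n)).ne'
  have h' : ∏ k ∈ Finset.Icc 1 n, N.mu i k ≠ 0 :=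
    Finset.prod_ne_zero_iff.2 fun k hk => (N.mu_pos i (Finset.mem_Icc.1 hk).1).ne'
  rw [weight, weight, Finset.prod_Icc_succ_top (Nat.succ_pos n), pow_succ]
  field_simp

theorem marginal_succ (i : Fin m) (n : ℕ) :
    N.marginal L i (n + 1) * N.mu i (n + 1) = N.marginal L i n * L i := by
  rw [marginal, marginal, div_mul_eq_mul_div, weight_succ, div_mul_eq_mul_div]

/-- Only the factor of queue `j` changes, by the ratio `L j / μ_j(n_j + 1)`. All balance equations
involving customers reduce to this one. -/
theorem stat_inc (D : Finset (Fin m)) (n : Fin m → ℕ) (j : Fin m) :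
    N.stat L (D, inc j n) * N.mu j (n j + 1) = N.stat L (D, n) * L j := by
  have h : (∏ i, N.marginal L i (inc j n i)) * N.mu j (n j + 1) =
      (∏ i, N.marginal L i (n i)) * L j := by
    rw [← Finset.mul_prod_erase _ _ (Finset.mem_univ j),
      ← Finset.mul_prod_erase _ (fun i => N.marginal L i (n i)) (Finset.mem_univ j),
      inc_apply_self, mul_right_comm, marginal_succ, mul_right_comm]
    congr 2
    refine Finset.prod_congr rfl fun i hi => ?_
    rw [inc, Function.update_of_ne (Finset.ne_of_mem_erase hi)]
  simp only [stat]
  rw [mul_assoc, h, mul_assoc]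

/-- Blocking erases rows and columns of the down nodes alike and puts the rejected mass on the
diagonal, where balance is trivial. -/
theorem blocked_balance (hrev : N.IsReversible L) (D : Finset (Fin m)) (i j : Option (Fin m)) :
    N.fullTraffic L i * N.blocked D i j = N.fullTraffic L j * N.blocked D j i := by
  rw [blocked, blocked]
  by_cases hij : i = j
  · subst hij; rfl
  · rw [if_neg hij, if_neg (Ne.symm hij)]
    simp only [or_comm (a := j ∈ D.image some)]
    split_ifs
    · simp
    · exact (hrev i j).symm

theorem traffic_pos (htail : ∀ i, StronglyLightTailed (N.marginal L i)) (i : Fin m) : 0 < L i := by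
  have h1 := (htail i).1 0
  have h2 := (htail i).1 1
  have h3 := N.marginal_succ (L := L) i 0
  have h4 : 0 < N.marginal L i 0 * L i := by
    rw [← h3]; exact mul_pos h2 (N.mu_pos i le_rfl)
  exact (mul_pos_iff_of_pos_left h1).1 h4

theorem statusSum_pos : 0 < ∑ D, N.psi D / N.phi D :=
  Finset.sum_pos (fun D _ => div_pos (N.psi_pos D) (N.phi_pos D)) Finset.univ_nonempty

theorem stat_pos (htail : ∀ i, StronglyLightTailed (N.marginal L i)) (x : State m) :
    0 < N.stat L x :=
  mul_pos (div_pos (div_pos (N.psi_pos _) (N.phi_pos _)) N.statusSum_pos)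
    (Finset.prod_pos fun i _ => (htail i).1 _)

theorem hasSum_stat (htail : ∀ i, StronglyLightTailed (N.marginal L i)) :
    HasSum (N.stat L) 1 := by
  set Z := ∑ D, N.psi D / N.phi D with hZ
  have h2 : HasSum (fun D => N.psi D / N.phi D / Z) 1 := by
    have h := hasSum_fintype fun D => N.psi D / N.phi D / Z
    rwa [← Finset.sum_div, ← hZ, div_self N.statusSum_pos.ne'] at h
  have h3 := h2.mul_of_nonneg (hasSum_prod_pi (fun i k => ((htail i).1 k).le)
    fun i => (htail i).2.1)
    (fun D => (div_pos (div_pos (N.psi_pos _) (N.phi_pos _)) N.statusSum_pos).le)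
    (fun n => Finset.prod_nonneg fun i _ => ((htail i).1 _).le)
  rw [mul_one] at h3
  exact h3

/-- The rate `μ_i` may be unbounded, yet the shift by `e_i` turns its stationary sum into `L i`
times a probability, states with empty queue `i` contributing nothing. This is what excludes
explosion. -/
theorem summable_stat_mul_mu (htail : ∀ i, StronglyLightTailed (N.marginal L i)) (i : Fin m) :
    Summable fun x : State m => N.stat L x * N.mu i (x.2 i) := by
  have hinj : Function.Injective fun x : State m => ((x.1, inc i x.2) : State m) := by
    intro x y h
    rw [Prod.mk.injEq] at h
    exact Prod.ext h.1 (inc_injective i h.2)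
  refine (hinj.summable_iff fun x hx => ?_).1 ?_
  · by_cases h : x.2 i = 0
    · rw [h, N.mu_zero, mul_zero]
    · exact absurd ⟨(x.1, dec i x.2), Prod.ext rfl (inc_dec h)⟩ hx
  · refine ((N.hasSum_stat htail).summable.mul_right (L i)).congr fun x => ?_
    simp only [Function.comp, inc_apply_self, stat_inc]

theorem summable_stat_mul_rate (htail : ∀ i, StronglyLightTailed (N.marginal L i)) (a : Move m) :
    Summable fun x : State m => N.stat L x * N.rate a x := by
  -- A factor depending on the status alone takes finitely many values, so it is bounded by their
  -- sum.
  have hstatus : ∀ (g : State m → ℝ) (F : Finset (Fin m) → ℝ), Summable g →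
      (∀ x, 0 ≤ g x) → (∀ D, 0 ≤ F D) → Summable fun x : State m => g x * F x.1 := by
    intro g F hg hg0 hF
    refine Summable.of_nonneg_of_le (fun x => mul_nonneg (hg0 x) (hF _))
      (fun x => mul_le_mul_of_nonneg_left
        (Finset.single_le_sum (fun D _ => hF D) (Finset.mem_univ x.1)) (hg0 x))
      (hg.mul_right (∑ D, F D))
  have hs := (N.hasSum_stat htail).summable
  have hs0 : ∀ x, 0 ≤ N.stat L x := fun x => (N.stat_pos htail x).le
  have hm0 : ∀ i (x : State m), 0 ≤ N.stat L x * N.mu i (x.2 i) := fun i x =>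
    mul_nonneg (hs0 x) (N.mu_nonneg _ _)
  match a with
  | .inl (.inl j) =>
    exact hstatus _ (fun D => N.lam * N.blocked D none (some j)) hs hs0 fun D =>
      mul_nonneg N.lam_pos.le (N.blocked_nonneg _ _ _)
  | .inl (.inr j) =>
    refine (hstatus _ (fun D => N.blocked D (some j) none) (N.summable_stat_mul_mu htail j)
      (hm0 j) fun D => N.blocked_nonneg _ _ _).congr fun x => ?_
    rw [rate, mul_assoc]
  | .inr (.inl a) =>
    refine (hstatus _ (fun D => N.blocked D (some a.1) (some a.2))
      (N.summable_stat_mul_mu htail a.1) (hm0 a.1) fun D => N.blocked_nonneg _ _ _).congr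
      fun x => ?_
    rw [rate, mul_assoc]
  | .inr (.inr (.inl I)) =>
    exact hstatus _ (fun D => N.rate (.inr (.inr (.inl I))) (D, 0)) hs hs0 fun D =>
      N.rate_nonneg _ _
  | .inr (.inr (.inr H)) =>
    exact hstatus _ (fun D => N.rate (.inr (.inr (.inr H))) (D, 0)) hs hs0 fun D =>
      N.rate_nonneg _ _

theorem stat_status (D D' : Finset (Fin m)) (n : Fin m → ℕ) :
    N.stat L (D, n) * (N.psi D' / N.phi D') = N.stat L (D', n) * (N.psi D / N.phi D) := by
  simp only [stat]; ring

theorem isReversibleMoves (hrev : N.IsReversible L)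
    (htail : ∀ i, StronglyLightTailed (N.marginal L i)) :
    IsReversibleMoves (N.stat L) N.gen tgt N.rate rev where
  pos := N.stat_pos htail
  sum := N.hasSum_stat htail
  rate_nonneg := N.rate_nonneg
  summable := N.summable_stat_mul_rate htail
  gen := N.gen_eq_sum_moves
  rev_rev a := by
    match a with
    | .inl (.inl j) => rfl
    | .inl (.inr j) => rfl
    | .inr (.inl a) => rfl
    | .inr (.inr (.inl I)) => rfl
    | .inr (.inr (.inr H)) => rfl
  tgt_rev a x h := by
    match a with
    | .inl (.inl j) => simp [tgt, rev]
    | .inl (.inr j) =>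
      have h0 : x.2 j ≠ 0 := fun h0 => h (by rw [rate, h0, N.mu_zero, zero_mul])
      simp [tgt, rev, inc_dec h0]
    | .inr (.inl a) =>
      have h0 : x.2 a.1 ≠ 0 := fun h0 => h (by rw [rate, h0, N.mu_zero, zero_mul])
      simp [tgt, rev, inc_dec h0]
    | .inr (.inr (.inl I)) =>
      have h0 : I ⊆ x.1ᶜ := by
        by_contra h0
        exact h (if_neg h0)
      have h1 : (x.1 ∪ I) \ I = x.1 := by
        rw [Finset.union_sdiff_right, Finset.sdiff_eq_self_iff_disjoint]
        exact Finset.disjoint_left.2 fun i hi hi' => Finset.mem_compl.1 (h0 hi') hi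
      simp only [tgt, rev, h1]
    | .inr (.inr (.inr H)) =>
      have h0 : H ⊆ x.1 := by
        by_contra h0
        exact h (if_neg h0)
      simp only [tgt, rev, Finset.sdiff_union_of_subset h0]
  balance a x h := by
    match a with
    | .inl (.inl j) =>
      have h1 := N.stat_inc (L := L) x.1 x.2 j
      have h2 := N.blocked_balance hrev x.1 none (some j)
      simp only [fullTraffic] at h2
      simp only [tgt, rev, rate, inc_apply_self]
      rw [h2, ← mul_assoc, ← mul_assoc, h1]
    | .inl (.inr j) =>
      have h0 : x.2 j ≠ 0 := fun h0 => h (by rw [rate, h0, N.mu_zero, zero_mul])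
      have h1 := N.stat_inc (L := L) x.1 (dec j x.2) j
      have h2 := N.blocked_balance hrev x.1 none (some j)
      have h3 : dec j x.2 j + 1 = x.2 j := by rw [← inc_apply_self, inc_dec h0]
      simp only [fullTraffic] at h2
      rw [inc_dec h0, h3] at h1
      simp only [tgt, rev, rate]
      rw [h2, ← mul_assoc, ← mul_assoc, h1]
    -- Both sides are compared at the intermediate vector `n - e_i`: leaving `i` carries `L i`
    -- there, leaving `j` after the move carries `L j`, and the blocked routing balances the two.
    -- The case `i = j` is included.
    | .inr (.inl (i, j)) =>
      have h0 : x.2 i ≠ 0 := fun h0 => h (by rw [rate, h0, N.mu_zero, zero_mul])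
      have h1 := N.stat_inc (L := L) x.1 (dec i x.2) i
      have h1' := N.stat_inc (L := L) x.1 (dec i x.2) j
      have h2 := N.blocked_balance hrev x.1 (some i) (some j)
      have h3 : dec i x.2 i + 1 = x.2 i := by rw [← inc_apply_self, inc_dec h0]
      simp only [fullTraffic] at h2
      rw [inc_dec h0, h3] at h1
      simp only [tgt, rev, rate, inc_apply_self]
      rw [← mul_assoc, ← mul_assoc, h1, h1', mul_assoc, mul_assoc, h2]
    | .inr (.inr (.inl I)) =>
      have h0 : I ⊆ x.1ᶜ := by
        by_contra h0
        exact h (if_neg h0)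
      have h1 : (x.1 ∪ I) \ I = x.1 := by
        rw [Finset.union_sdiff_right, Finset.sdiff_eq_self_iff_disjoint]
        exact Finset.disjoint_left.2 fun i hi hi' => Finset.mem_compl.1 (h0 hi') hi
      have h2 := N.stat_status (L := L) x.1 (x.1 ∪ I) x.2
      have := (N.psi_pos x.1).ne'
      have := (N.phi_pos x.1).ne'
      have := (N.phi_pos (x.1 ∪ I)).ne'
      simp only [tgt, rev, rate, h1]
      rw [if_pos h0, if_pos Finset.subset_union_right]
      field_simp at h2 ⊢
      linarith
    | .inr (.inr (.inr H)) =>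
      have h0 : H ⊆ x.1 := by
        by_contra h0
        exact h (if_neg h0)
      have h1 : H ⊆ (x.1 \ H)ᶜ := fun i hi => by simp [hi]
      have h2 := N.stat_status (L := L) x.1 (x.1 \ H) x.2
      have := (N.psi_pos (x.1 \ H)).ne'
      have := (N.phi_pos x.1).ne'
      have := (N.phi_pos (x.1 \ H)).ne'
      simp only [tgt, rev, rate, Finset.sdiff_union_of_subset h0]
      rw [if_pos h0, if_pos h1]
      field_simp at h2 ⊢
      linarith

end Stat

end JacksonNetwork

namespace JacksonNetwork

open MarkovChain

variable {m : ℕ} (N : JacksonNetwork m) (L : Fin m → ℝ)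

/-! ### The Poincaré inequality of the network -/

/-- The increments of a function between `A x` and `B x` are controlled in mean square by the
Dirichlet form. -/
def Controlled (A B : State m → State m) : Prop :=
  ∃ K : ℝ≥0∞, K ≠ ∞ ∧ ∀ f : State m → ℝ,
    ∑' x, ENNReal.ofReal (N.stat L x) * ENNReal.ofReal ((f (A x) - f (B x)) ^ 2) ≤
      K * IsReversibleMoves.energy (N.stat L) N.gen f

/-- The image of the stationary distribution under `S` has a bounded density. -/
def Dominated (S : State m → State m) : Prop :=
  ∃ K : ℝ≥0∞, K ≠ ∞ ∧ ∀ g : State m → ℝ≥0∞,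
    ∑' x, ENNReal.ofReal (N.stat L x) * g (S x) ≤ K * ∑' x, ENNReal.ofReal (N.stat L x) * g x

variable {N L}

theorem Controlled.refl (A : State m → State m) : N.Controlled L A A :=
  ⟨0, by simp, fun f => by simp⟩

theorem Controlled.symm {A B : State m → State m} (h : N.Controlled L A B) :
    N.Controlled L B A := by
  obtain ⟨K, hK, h⟩ := h
  refine ⟨K, hK, fun f => le_of_eq_of_le ?_ (h f)⟩
  congr 1; funext x
  congr 2; ring

theorem Controlled.trans {A B C : State m → State m} (h₁ : N.Controlled L A B)
    (h₂ : N.Controlled L B C) : N.Controlled L A C := by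
  obtain ⟨K₁, hK₁, h₁⟩ := h₁
  obtain ⟨K₂, hK₂, h₂⟩ := h₂
  refine ⟨2 * (K₁ + K₂), ENNReal.mul_ne_top (by simp) (ENNReal.add_ne_top.2 ⟨hK₁, hK₂⟩),
    fun f => ?_⟩
  have hpt : ∀ x, ENNReal.ofReal (N.stat L x) * ENNReal.ofReal ((f (A x) - f (C x)) ^ 2) ≤
      2 * (ENNReal.ofReal (N.stat L x) * ENNReal.ofReal ((f (A x) - f (B x)) ^ 2) +
        ENNReal.ofReal (N.stat L x) * ENNReal.ofReal ((f (B x) - f (C x)) ^ 2)) := by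
    intro x
    rw [← mul_add, ← ENNReal.ofReal_add (sq_nonneg _) (sq_nonneg _), mul_left_comm,
      show (2 : ℝ≥0∞) = ENNReal.ofReal 2 by simp, ← ENNReal.ofReal_mul (p := 2) (by norm_num)]
    refine mul_le_mul_right (ENNReal.ofReal_le_ofReal ?_) _
    nlinarith [sq_nonneg (f (A x) - f (B x) - (f (B x) - f (C x)))]
  refine (ENNReal.tsum_le_tsum hpt).trans ?_
  rw [ENNReal.tsum_mul_left, ENNReal.tsum_add, mul_assoc, add_mul]
  gcongr
  · exact h₁ f
  · exact h₂ f

/-- Change of variables along `S`: the bounded density lets an estimate be reused after part of the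
state has been reset. -/
theorem Controlled.comp {A B S : State m → State m} (h : N.Controlled L A B)
    (hS : N.Dominated L S) : N.Controlled L (A ∘ S) (B ∘ S) := by
  obtain ⟨K, hK, h⟩ := h
  obtain ⟨K', hK', hS⟩ := hS
  refine ⟨K' * K, ENNReal.mul_ne_top hK' hK, fun f => ?_⟩
  refine (hS fun x => ENNReal.ofReal ((f (A x) - f (B x)) ^ 2)).trans ?_
  rw [mul_assoc]
  gcongr
  exact h f

/-- Repairing all servers. -/
def repairAll (x : State m) : State m := (∅, x.2)

/-- Emptying the queue `i`. -/
def clearQueue (i : Fin m) (x : State m) : State m := (x.1, Function.update x.2 i 0)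

/-- A single repair move suffices, since the whole down set may be repaired at once; the constant
for `H` is the inverse of its repair rate. -/
theorem controlled_repairAll (hM : IsReversibleMoves (N.stat L) N.gen tgt N.rate rev) :
    N.Controlled L id repairAll := by
  refine ⟨∑ H : Finset (Fin m), ENNReal.ofReal (N.phi ∅ / N.phi H),
    by simp [ENNReal.sum_eq_top], fun f => ?_⟩
  have hpt : ∀ x : State m, ENNReal.ofReal (N.stat L x) *
      ENNReal.ofReal ((f (id x) - f (repairAll x)) ^ 2) ≤
      ∑ H : Finset (Fin m), ENNReal.ofReal (N.phi ∅ / N.phi H) *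
        ENNReal.ofReal (N.stat L x * N.rate (.inr (.inr (.inr H))) x *
          (f (tgt (.inr (.inr (.inr H))) x) - f x) ^ 2) := by
    intro x
    refine le_trans (le_of_eq ?_) (Finset.single_le_sum (fun _ _ => zero_le)
      (Finset.mem_univ x.1))
    have h1 := (N.phi_pos ∅).ne'
    have h2 := (N.phi_pos x.1).ne'
    rw [← ENNReal.ofReal_mul (hM.pos x).le,
      ← ENNReal.ofReal_mul (div_pos (N.phi_pos _) (N.phi_pos _)).le]
    congr 1
    simp only [rate, tgt, repairAll, id, Finset.Subset.refl, if_true, Finset.sdiff_self]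
    field_simp
    ring
  refine (ENNReal.tsum_le_tsum hpt).trans ?_
  rw [Summable.tsum_finsetSum (fun _ _ => ENNReal.summable), Finset.sum_mul]
  refine Finset.sum_le_sum fun H _ => ?_
  rw [ENNReal.tsum_mul_left]
  gcongr
  exact hM.tsum_move_le_energy _ f

theorem tsum_state (F : State m → ℝ≥0∞) :
    ∑' x, F x = ∑ D, ∑' n, F (D, n) := by
  rw [ENNReal.tsum_prod', tsum_fintype]

/-- It suffices to control increments on the states where no server is down. -/
theorem controlled_of_repaired {A B : State m → State m} {K : ℝ≥0∞} (hK : K ≠ ∞)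
    (h : ∀ f : State m → ℝ, ∑' n, ENNReal.ofReal (N.stat L (∅, n)) *
      ENNReal.ofReal ((f (A (∅, n)) - f (B (∅, n))) ^ 2) ≤
        K * IsReversibleMoves.energy (N.stat L) N.gen f) :
    N.Controlled L (A ∘ repairAll) (B ∘ repairAll) := by
  refine ⟨∑ D : Finset (Fin m), ENNReal.ofReal ((N.psi D / N.phi D) / (N.psi ∅ / N.phi ∅)) * K,
    by simp [ENNReal.sum_eq_top, ENNReal.mul_eq_top, hK], fun f => ?_⟩
  rw [tsum_state, Finset.sum_mul]
  refine Finset.sum_le_sum fun D _ => ?_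
  have h2 : ∀ n, ENNReal.ofReal (N.stat L (D, n)) =
      ENNReal.ofReal ((N.psi D / N.phi D) / (N.psi ∅ / N.phi ∅)) *
        ENNReal.ofReal (N.stat L (∅, n)) := by
    intro n
    rw [← ENNReal.ofReal_mul
      (div_pos (div_pos (N.psi_pos _) (N.phi_pos _)) (div_pos (N.psi_pos _) (N.phi_pos _))).le]
    congr 1
    have h1 := N.stat_status (L := L) D ∅ n
    have := (div_pos (N.psi_pos ∅) (N.phi_pos ∅)).ne'
    rw [div_mul_eq_mul_div, eq_div_iff this, h1, mul_comm]
  simp only [h2, mul_assoc]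
  rw [ENNReal.tsum_mul_left]
  gcongr
  exact h f

/-- Adding a customer to a node; nothing is added for the outside. -/
def addTo : Option (Fin m) → State m → State m
  | none, x => x
  | some j, x => (x.1, inc j x.2)

theorem blocked_empty {i j : Option (Fin m)} (hij : i ≠ j) : N.blocked ∅ i j = N.r i j := by
  simp [blocked, hij]

/-- If the move `a` leads from `S n` to `T n`, then the corresponding increments are bounded by the
Dirichlet form. -/
theorem tsum_increment_le (hM : IsReversibleMoves (N.stat L) N.gen tgt N.rate rev)
    (a : Move m) (S T : (Fin m → ℕ) → State m) (hS : Function.Injective S) {c : ℝ} (hc : 0 < c)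
    (hT : ∀ n, tgt a (S n) = T n)
    (hw : ∀ n, N.stat L (∅, n) * c ≤ N.stat L (S n) * N.rate a (S n)) (f : State m → ℝ) :
    ∑' n, ENNReal.ofReal (N.stat L (∅, n)) * ENNReal.ofReal ((f (T n) - f (S n)) ^ 2) ≤
      ENNReal.ofReal c⁻¹ * IsReversibleMoves.energy (N.stat L) N.gen f := by
  have h1 := (ENNReal.tsum_comp_le_tsum_of_injective hS fun x =>
    ENNReal.ofReal (N.stat L x * N.rate a x * (f (tgt a x) - f x) ^ 2)).trans
    (hM.tsum_move_le_energy a f)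
  refine le_trans ?_ (mul_le_mul_right h1 _)
  rw [← ENNReal.tsum_mul_left]
  refine ENNReal.tsum_le_tsum fun n => ?_
  rw [← ENNReal.ofReal_mul (hM.pos _).le, ← ENNReal.ofReal_mul (inv_pos.2 hc).le, hT]
  refine ENNReal.ofReal_le_ofReal ?_
  rw [← mul_assoc]
  refine mul_le_mul_of_nonneg_right ?_ (sq_nonneg _)
  rw [le_inv_mul_iff₀ hc, mul_comm]
  exact hw n

/-- With all servers up, one arrival or migration realises the comparison. A migration starts from
`n + e_i`, whose weight times `μ_i` is `L i` times the weight of `n`. An edge towards the outside is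
read backwards as an arrival, by reversibility. -/
theorem controlled_addTo_of_pos (hM : IsReversibleMoves (N.stat L) N.gen tgt N.rate rev)
    (hrev : N.IsReversible L) (hL : ∀ i, 0 < L i) (i j : Option (Fin m)) (hij : 0 < N.r i j) :
    N.Controlled L (addTo i ∘ repairAll) (addTo j ∘ repairAll) := by
  have harr : ∀ j : Fin m, 0 < N.r none (some j) →
      N.Controlled L (addTo none ∘ repairAll) (addTo (some j) ∘ repairAll) := by
    intro j hj
    refine Controlled.symm (controlled_of_repaired
      (K := ENNReal.ofReal (N.lam * N.r none (some j))⁻¹) ENNReal.ofReal_ne_top fun f => ?_)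
    refine tsum_increment_le hM (.inl (.inl j)) (fun n => (∅, n)) (fun n => (∅, inc j n))
      (Prod.mk_right_injective _) (mul_pos N.lam_pos hj) (fun n => rfl) (fun n => ?_) f
    rw [rate, blocked_empty (by simp)]
  match i, j with
  | none, none => exact Controlled.refl _
  | none, some j => exact harr j hij
  | some i, none =>
    refine (harr i ?_).symm
    have h := hrev none (some i)
    simp only [fullTraffic] at h
    have := mul_pos (hL i) hij
    rw [h] at this
    exact (mul_pos_iff_of_pos_left N.lam_pos).1 this
  | some i, some j =>
    by_cases hne : i = j
    · rw [hne]; exact Controlled.refl _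
    refine Controlled.symm (controlled_of_repaired
      (K := ENNReal.ofReal (L i * N.r (some i) (some j))⁻¹) ENNReal.ofReal_ne_top fun f => ?_)
    refine tsum_increment_le hM (.inr (.inl (i, j))) (fun n => (∅, inc i n))
      (fun n => (∅, inc j n)) (fun n n' h => inc_injective i (Prod.ext_iff.1 h).2)
      (mul_pos (hL i) hij) (fun n => by simp [tgt]) (fun n => ?_) f
    rw [rate, blocked_empty (by simpa using hne)]
    simp only [inc_apply_self]
    rw [← mul_assoc, ← mul_assoc, N.stat_inc]

theorem pow_nonneg_apply (k : ℕ) (i j : Option (Fin m)) : 0 ≤ (N.r ^ k) i j := by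
  induction k generalizing j with
  | zero => rw [pow_zero, Matrix.one_apply]; split_ifs <;> norm_num
  | succ k ih =>
    rw [pow_succ, Matrix.mul_apply]
    exact Finset.sum_nonneg fun a _ => mul_nonneg (ih a) (N.r_nonneg a j)

/-- A positive entry of a power of the routing matrix yields a path from the outside to `j`; the
extra customer is carried along it edge by edge. This handles nodes without direct arrivals. -/
theorem controlled_addTo (hM : IsReversibleMoves (N.stat L) N.gen tgt N.rate rev)
    (hrev : N.IsReversible L) (hL : ∀ i, 0 < L i) (hreg : N.IsRegular) (j : Option (Fin m)) :
    N.Controlled L repairAll (addTo j ∘ repairAll) := by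
  obtain ⟨k, -, hk⟩ := hreg
  have h : ∀ (k : ℕ) (j : Option (Fin m)), 0 < (N.r ^ k) none j →
      N.Controlled L repairAll (addTo j ∘ repairAll) := by
    intro k
    induction k with
    | zero =>
      intro j hj
      rw [pow_zero, Matrix.one_apply] at hj
      split_ifs at hj with h
      · subst h; exact Controlled.refl _
      · exact absurd hj (lt_irrefl _)
    | succ k ih =>
      intro j hj
      rw [pow_succ, Matrix.mul_apply] at hj
      obtain ⟨i, -, hi⟩ := Finset.exists_lt_of_sum_lt (s := Finset.univ)
        (f := fun _ : Option (Fin m) => (0 : ℝ)) (g := fun i => (N.r ^ k) none i * N.r i j)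
        (by rwa [Finset.sum_const_zero])
      have h1 := N.r_nonneg i j
      have h2 := pow_nonneg_apply (N := N) k none i
      have h3 : 0 < (N.r ^ k) none i := lt_of_le_of_ne h2 fun h => by simp [← h] at hi
      have h4 : 0 < N.r i j := lt_of_le_of_ne h1 fun h => by simp [← h] at hi
      exact (ih i h3).trans (controlled_addTo_of_pos hM hrev hL i j h4)
  exact h k j (hk none j)

/-- A queue length vector is determined by the length of the queue `i` and by the vector where
this queue is emptied. -/
def splitQueue (i : Fin m) : (Fin m → ℕ) ≃ {n : Fin m → ℕ // n i = 0} × ℕ where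
  toFun n := (⟨Function.update n i 0, by simp⟩, n i)
  invFun z := Function.update z.1.1 i z.2
  left_inv n := by simp
  right_inv z := by
    obtain ⟨⟨n, hn⟩, k⟩ := z
    simp [← hn]

theorem tsum_splitQueue (i : Fin m) (F : (Fin m → ℕ) → ℝ≥0∞) :
    ∑' n, F n = ∑' n : {n : Fin m → ℕ // n i = 0}, ∑' k, F (Function.update n.1 i k) := by
  rw [← (splitQueue i).symm.tsum_eq, ENNReal.tsum_prod']
  rfl

/-- The stationary weight without the factor of the queue `i`. -/
def restWeight (N : JacksonNetwork m) (L : Fin m → ℝ) (i : Fin m) (D : Finset (Fin m))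
    (n : Fin m → ℕ) : ℝ :=
  (N.psi D / N.phi D) / (∑ D, N.psi D / N.phi D) *
    ∏ j ∈ Finset.univ.erase i, N.marginal L j (n j)

theorem stat_update (i : Fin m) (D : Finset (Fin m)) (n : Fin m → ℕ) (k : ℕ) :
    N.stat L (D, Function.update n i k) = restWeight N L i D n * N.marginal L i k := by
  simp only [stat, restWeight]
  rw [← Finset.mul_prod_erase _ _ (Finset.mem_univ i), Function.update_self, mul_assoc,
    mul_comm (N.marginal L i k)]
  congr 2
  refine Finset.prod_congr rfl fun j hj => ?_
  rw [Function.update_of_ne (Finset.ne_of_mem_erase hj)]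

theorem restWeight_nonneg (htail : ∀ i, StronglyLightTailed (N.marginal L i)) (i : Fin m)
    (D : Finset (Fin m)) (n : Fin m → ℕ) : 0 ≤ restWeight N L i D n :=
  mul_nonneg (div_pos (div_pos (N.psi_pos _) (N.phi_pos _)) N.statusSum_pos).le
    (Finset.prod_nonneg fun j _ => ((htail j).1 _).le)

/-- Emptying queue `i` collapses its marginal, of total mass one, onto length `0`, so the density
there is `1 / π_i(0)`. -/
theorem dominated_clearQueue (htail : ∀ i, StronglyLightTailed (N.marginal L i)) (i : Fin m) :
    N.Dominated L (clearQueue i) := by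
  have h0 := (htail i).1 0
  refine ⟨ENNReal.ofReal (N.marginal L i 0)⁻¹, ENNReal.ofReal_ne_top, fun g => ?_⟩
  rw [tsum_state, tsum_state, Finset.mul_sum]
  refine Finset.sum_le_sum fun D _ => ?_
  rw [tsum_splitQueue i, tsum_splitQueue i, ← ENNReal.tsum_mul_left]
  refine ENNReal.tsum_le_tsum fun n => ?_
  have hn : Function.update n.1 i 0 = n.1 := by
    conv_rhs => rw [← Function.update_eq_self i n.1, n.2]
  have hR := restWeight_nonneg htail i D n.1
  simp only [stat_update, clearQueue, Function.update_idem, hn, ENNReal.ofReal_mul hR]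
  rw [ENNReal.tsum_mul_right, ENNReal.tsum_mul_left,
    ← ENNReal.ofReal_tsum_of_nonneg (fun k => ((htail i).1 k).le) (htail i).2.1.summable,
    (htail i).2.1.tsum_eq, ENNReal.ofReal_one, mul_one]
  refine le_trans (le_of_eq ?_) (mul_le_mul_right (ENNReal.le_tsum 0) _)
  have hp : ENNReal.ofReal (N.marginal L i 0)⁻¹ * ENNReal.ofReal (N.marginal L i 0) = 1 := by
    rw [← ENNReal.ofReal_mul (inv_pos.2 h0).le, inv_mul_cancel₀ h0.ne', ENNReal.ofReal_one]
  rw [hn, mul_right_comm, mul_comm _ (ENNReal.ofReal (N.marginal L i 0)), ← mul_assoc, hp, one_mul]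

/-- With the status and the other queues frozen, the product form leaves a constant weight, and the
Hardy inequality in the length of queue `i` replaces emptying it by adding one customer. -/
theorem controlled_clearQueue (htail : ∀ i, StronglyLightTailed (N.marginal L i)) (i : Fin m)
    (hadd : N.Controlled L repairAll (addTo (some i) ∘ repairAll)) :
    N.Controlled L repairAll (repairAll ∘ clearQueue i) := by
  obtain ⟨C, hC, hardy⟩ := (htail i).exists_hardy
  obtain ⟨K, hK, hadd⟩ := hadd
  refine ⟨ENNReal.ofReal C * K, ENNReal.mul_ne_top ENNReal.ofReal_ne_top hK, fun f => ?_⟩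
  rw [mul_assoc]
  refine le_trans ?_ (mul_le_mul_right (hadd f) _)
  rw [tsum_state, tsum_state, Finset.mul_sum]
  refine Finset.sum_le_sum fun D _ => ?_
  rw [tsum_splitQueue i, tsum_splitQueue i, ← ENNReal.tsum_mul_left]
  refine ENNReal.tsum_le_tsum fun n => ?_
  have hR := restWeight_nonneg htail i D n.1
  simp only [stat_update, ENNReal.ofReal_mul hR, mul_assoc]
  rw [ENNReal.tsum_mul_left, ENNReal.tsum_mul_left, mul_left_comm]
  refine mul_le_mul_right (le_of_eq_of_le ?_
    ((hardy fun k => f (∅, Function.update n.1 i k)).trans (le_of_eq ?_))) _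
  · simp [repairAll, clearQueue]
  · congr 2
    funext k
    simp only [repairAll, addTo, Function.comp, inc, Function.update_self, Function.update_idem]
    congr 2
    ring

/-- The state with all servers up and all queues empty. -/
def origin : State m := (∅, 0)

/-- After the repair, queues are emptied one at a time. The remaining stages are evaluated at the
state with queue `i` cleared, which `dominated_clearQueue` permits. -/
theorem controlled_origin (htail : ∀ i, StronglyLightTailed (N.marginal L i))
    (hM : IsReversibleMoves (N.stat L) N.gen tgt N.rate rev)
    (hrev : N.IsReversible L) (hreg : N.IsRegular) :
    N.Controlled L id fun _ => origin := by
  refine (controlled_repairAll hM).trans ?_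
  have h : ∀ S : Finset (Fin m), N.Controlled L repairAll
      fun x => (∅, fun j => if j ∈ S then 0 else x.2 j) := by
    intro S
    induction S using Finset.induction_on with
    | empty => exact Controlled.refl _
    | insert i S _ ih =>
      have h1 := controlled_clearQueue htail i
        (controlled_addTo hM hrev (N.traffic_pos htail) hreg (some i))
      have h2 := h1.trans (ih.comp (dominated_clearQueue htail i))
      convert h2 using 1
      funext x
      simp only [Function.comp, clearQueue, Prod.mk.injEq, true_and]
      funext j
      by_cases hj : j = i <;> simp [hj]
  convert h Finset.univ using 1
  funext x
  simp [origin]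
  rfl

theorem exists_poincare (htail : ∀ i, StronglyLightTailed (N.marginal L i))
    (hM : IsReversibleMoves (N.stat L) N.gen tgt N.rate rev)
    (hrev : N.IsReversible L) (hreg : N.IsRegular) :
    ∃ K : ℝ, 0 < K ∧ ∀ f : State m → ℝ,
      ∑' x, ENNReal.ofReal (N.stat L x * (f x - f origin) ^ 2) ≤
        ENNReal.ofReal K * IsReversibleMoves.energy (N.stat L) N.gen f := by
  obtain ⟨K, hK, h⟩ := controlled_origin htail hM hrev hreg
  -- The constant found may be zero, hence the added `1`.
  refine ⟨K.toReal + 1, by positivity, fun f => ?_⟩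
  simp only [ENNReal.ofReal_mul (hM.pos _).le]
  refine (h f).trans (mul_le_mul_left ?_ _)
  rw [ENNReal.le_ofReal_iff_toReal_le hK (by positivity)]
  linarith

end JacksonNetwork

end

/-! ### Conclusion for the network -/

theorem proposition2 (m : ℕ) (hm : 1 ≤ m) (N : JacksonNetwork m) (L : Fin m → ℝ)
    (hL : N.IsTraffic L) (hrev : N.IsReversible L) (hreg : N.IsRegular)
    (htail : ∀ i, StronglyLightTailed (N.marginal L i)) :
    MarkovChain.IsStationary N.P (N.stat L) ∧
    0 < N.spectralGap L ∧
    (∀ f : JacksonNetwork.State m → ℝ, MarkovChain.MemL2 (N.stat L) f → ∀ t : ℝ, 0 < t →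
      (∀ x, Summable fun y => N.P t x y * f y) ∧
      MarkovChain.MemL2 (N.stat L) (MarkovChain.act N.P t f) ∧
      MarkovChain.norm2 (N.stat L)
          (fun x => MarkovChain.act N.P t f x - MarkovChain.mean (N.stat L) f) ≤
        Real.exp (-N.spectralGap L * t) *
          MarkovChain.norm2 (N.stat L) (fun x => f x - MarkovChain.mean (N.stat L) f)) ∧
    (∀ x : JacksonNetwork.State m, ∃ C : ℝ, 0 < C ∧ ∀ t : ℝ, 0 < t →
      MarkovChain.tvNorm (N.P t x) (N.stat L) ≤
        ENNReal.ofReal (C * Real.exp (-N.spectralGap L * t))) := by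
  have hM := N.isReversibleMoves hrev htail
  have hR : MarkovChain.IsReversibleRates (N.stat L) N.q N.gen := hM.isReversibleRates
  have hP := hR.isReversibleSemigroup
  obtain ⟨K, hK, hpoin⟩ := JacksonNetwork.exists_poincare htail hM hrev hreg
  -- A second state is needed for normalised mean-zero functions to exist; it is available because
  -- there is at least one node.
  have hne : ((Finset.univ, 0) : JacksonNetwork.State m) ≠ JacksonNetwork.origin := by
    intro h
    have h1 : (Finset.univ : Finset (Fin m)) = ∅ := (Prod.ext_iff.1 h).1
    exact Finset.notMem_empty (⟨0, hm⟩ : Fin m) (h1 ▸ Finset.mem_univ _)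
  refine ⟨hP.isStationary, hR.gap_pos JacksonNetwork.origin hK hpoin hne, fun f hf t ht =>
    ⟨hP.summable_mul ht.le hf, hP.memL2_act ht.le hf,
      hR.norm2_act_sub_mean_le JacksonNetwork.origin hK hpoin hf ht.le⟩,
    hR.exists_tvNorm_le JacksonNetwork.origin hK hpoin⟩
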